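/- **Theorem (Short Separations).** Let $h\colon[0,1]\to\mathbb R$ be continuous and non-increasing with $h(0)=1$, $h(1)=0$ and $h(\zeta)<1$ for all $\zeta\in(0,1]$. For $\rho>0$ and $0<\alpha<\pi/2$ put $s_\alpha=\rho\alpha/\int_0^1h$. Let $\Gamma$ be the convex curve obtained from a semicircle of radius $\rho$ by replacing the arc of angle $\alpha$ (and length $\rho\alpha$) at each of its two ends by a smoothened segment of arc length $s_\alpha$ whose curvature, at arc length $s\in[0,s_\alpha]$ from the remaining circular arc, is $\frac1\rho h(s/s_\alpha)$; the curve $\Gamma$ is symmetric about its central axis. For $L\ge0$, the $C^2$-stadium with separation $L$ is the convex billiard table bounded by two copies of $\Gamma$ facing each other, whose endpoints are connected by two parallel straight line segments of length $L$ (for $L=0$ the two copies are joined at their endpoints). Suppose that the smoothened segment is less than twice as long as the circular arc it replaces, i.e. $s_\alpha<2\rho\alpha$, and that $h$ satisfies the non-degeneracy condition (C) there is an integer $n_*\ge0$ such that $\frac{2n_*+1}{2n_*+2}<\int_0^1h(\xi)\,d\xi$, and $h(\zeta)\ne\frac{2n_*+3/2}{2n_*+2}$ for every $\zeta\in[0,1]$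 with $\frac{2n_*+1}{2n_*+2}(1-\zeta)=\int_\zeta^1h(\xi)\,d\xi$. Then there is $\alpha_0>0$, depending only on $h$, such that for every $0<\alpha<\alpha_0$ and every $\rho>0$ there is $L_{h,\alpha}>0$ (depending also on the length scale $\rho$) such that for every $L$ with $0\le L<L_{h,\alpha}$ the corresponding $C^2$-stadium has an elliptic periodic billiard orbit, that is, a periodic orbit at which the return map of the billiard map is differentiable, and its derivative has determinant $1$ and trace of modulus less than $2$ (so its eigenvalues are non-real and of modulus one). -/

import Mathlib

open MeasureTheory Set

/-! ### The boundary of a smoothened stadium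

The plane is `ℂ`, the boundary is parametrized by arc length and traversed counterclockwise. -/

/-- Arc length `s_α` of a smoothened segment that turns by the angle `α`, has curvature
`h (t / s_α) / ρ` at arc length `t ∈ [0, s_α]`, and replaces a circular arc of radius `ρ` and
length `ρ * α`. -/
noncomputable def smoothenedLength (h : ℝ → ℝ) (ρ α : ℝ) : ℝ :=
  ρ * α / ∫ ξ in (0 : ℝ)..1, h ξ

/-- Half of the arc length of the focusing component `Γ`: half of the remaining circular arc
(angle `π / 2 - α`), followed by one smoothened segment. -/
noncomputable def halfLength (h : ℝ → ℝ) (ρ α : ℝ) : ℝ :=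
  ρ * (Real.pi / 2 - α) + smoothenedLength h ρ α

/-- Curvature of `Γ` at signed arc length `t` from its midpoint: `1 / ρ` on the circular part,
the rescaled shape function on the two smoothened segments, and `0` (straight line) beyond the
endpoints of `Γ`. -/
noncomputable def componentCurvature (h : ℝ → ℝ) (ρ α t : ℝ) : ℝ :=
  if |t| ≤ ρ * (Real.pi / 2 - α) then 1 / ρ
  else if |t| ≤ halfLength h ρ α then
    1 / ρ * h ((|t| - ρ * (Real.pi / 2 - α)) / smoothenedLength h ρ α)
  else 0

/-- Half of the perimeter of the stadium: one copy of `Γ` and one straight segment. -/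
noncomputable def stadiumHalfPerimeter (h : ℝ → ℝ) (ρ α L : ℝ) : ℝ :=
  2 * halfLength h ρ α + L

/-- Curvature of the boundary of the stadium. The midpoints of the two copies of `Γ` sit at the
multiples of the half perimeter; between two consecutive copies there is a straight segment of
length `L`. -/
noncomputable def stadiumCurvature (h : ℝ → ℝ) (ρ α L s : ℝ) : ℝ :=
  componentCurvature h ρ α
    (s - stadiumHalfPerimeter h ρ α L * (round (s / stadiumHalfPerimeter h ρ α L) : ℝ))

/-- Angle of the tangent of the boundary of the stadium. The tangent is vertical at the midpoint
`s = 0` of the right copy of `Γ`. -/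
noncomputable def stadiumTangentAngle (h : ℝ → ℝ) (ρ α L s : ℝ) : ℝ :=
  Real.pi / 2 + ∫ u in (0 : ℝ)..s, stadiumCurvature h ρ α L u

/-! ### Billiards inside a closed convex curve

The curve is given by its tangent angle `θ` as a function of arc length, and has perimeter `ℓ`. A
point of the phase space is a pair `(s, φ)`: a boundary point and the angle `φ ∈ (-π/2, π/2)`
between the outgoing velocity and the inner normal. Arc length is lifted from `ℝ / ℓℤ` to `ℝ`. -/

/-- The unit vector of angle `x`. -/
noncomputable def unitVec (x : ℝ) : ℂ := Complex.exp ((x : ℂ) * Complex.I)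

/-- The curve parametrized by arc length with tangent angle `θ`, starting at the origin. -/
noncomputable def boundaryCurve (θ : ℝ → ℝ) (s : ℝ) : ℂ := ∫ u in (0 : ℝ)..s, unitVec (θ u)

/-- The unit normal of the curve, which points inwards for a counterclockwise curve. -/
noncomputable def innerNormal (θ : ℝ → ℝ) (s : ℝ) : ℂ := unitVec (θ s + Real.pi / 2)

/-- The outgoing unit velocity at a point of the phase space. -/
noncomputable def velocity (θ : ℝ → ℝ) (z : ℝ × ℝ) : ℂ := unitVec (θ z.1 + Real.pi / 2 - z.2)

/-- `w` is the collision that follows `z`: the particle leaves the boundary point of `z`, moves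
on a straight line to the boundary point of `w`, and is reflected specularly there. -/
def IsNextCollision (θ : ℝ → ℝ) (ℓ : ℝ) (z w : ℝ × ℝ) : Prop :=
  |z.2| < Real.pi / 2 ∧ |w.2| < Real.pi / 2 ∧ z.1 < w.1 ∧ w.1 < z.1 + ℓ ∧
    (∃ τ : ℝ, 0 < τ ∧ boundaryCurve θ w.1 = boundaryCurve θ z.1 + (τ : ℂ) * velocity θ z) ∧
    velocity θ w = velocity θ z
      - ((2 * inner ℝ (velocity θ z) (innerNormal θ w.1) : ℝ) : ℂ) * innerNormal θ w.1

open Classical in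
/-- The billiard map, lifted to `ℝ × (-π/2, π/2)`. Points without a next collision (there are
none with `|φ| < π/2` on a convex table) are fixed by convention. -/
noncomputable def billiardMap (θ : ℝ → ℝ) (ℓ : ℝ) (z : ℝ × ℝ) : ℝ × ℝ :=
  if hz : ∃ w, IsNextCollision θ ℓ z w then hz.choose else z

/-- There is a periodic billiard orbit at which the return map is differentiable, and its
derivative (the monodromy matrix) is elliptic: it has determinant one and its trace has modulus
less than two, so that its eigenvalues are non-real and lie on the unit circle. -/
def HasEllipticPeriodicOrbit (θ : ℝ → ℝ) (ℓ : ℝ) : Prop :=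
  ∃ (p : ℕ) (z : ℝ × ℝ), 0 < p ∧
    (∀ i < p, IsNextCollision θ ℓ ((billiardMap θ ℓ)^[i] z) ((billiardMap θ ℓ)^[i + 1] z)) ∧
    (∃ k : ℤ, (billiardMap θ ℓ)^[p] z = (z.1 + k * ℓ, z.2)) ∧
    ∃ A : (ℝ × ℝ) →L[ℝ] (ℝ × ℝ), HasFDerivAt ((billiardMap θ ℓ)^[p]) A z ∧
      A.det = 1 ∧ |LinearMap.trace ℝ (ℝ × ℝ) A.toLinearMap| < 2

/-! ### The condition on the shape function -/

/-- The non-degeneracy condition (C) on the shape function. -/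
def ShapeNondegenerate (h : ℝ → ℝ) : Prop :=
  ∃ n : ℕ, (2 * n + 1 : ℝ) / (2 * n + 2) < ∫ ξ in (0 : ℝ)..1, h ξ ∧
    ∀ ζ ∈ Icc (0 : ℝ) 1,
      (2 * n + 1 : ℝ) / (2 * n + 2) * (1 - ζ) = ∫ ξ in ζ..1, h ξ →
        h ζ ≠ (2 * n + 3 / 2 : ℝ) / (2 * n + 2)

/-! As `α` and `L` tend to 0 the table tends to a disc. The orbit sought is a perturbation of the
regular polygon with `4 n + 4` vertices that has one vertex at the top and one at the bottom, where
the copies of `Γ` meet. Each circular arc carries `2 n + 1` collisions; the two exceptional ones lie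
on smoothened segments, at the fraction `ζ` of their length, and are mirror images in the horizontal
axis.

On an arc the chords are tangent to a concentric caustic and subtend a constant angle, `β` on the
right and `β'` on the left. The law of reflection at the exceptional point expresses both through
their mean `μ` and the rest angle `η` of the tangent. Two unknowns `ζ`, `μ` remain, and two
equations: the exceptional point lies on a prescribed tangent of either caustic. The sum of the
equations is strictly increasing in `μ` and pins it near `π / (2 n + 2)`. The difference has order
`α`; divided by `α` it tends to a positive multiple of `κ (1 - ζ) - ∫_ζ^1 h` with `κ = (2 n + 1) /
(2 n + 2)`, which is the equation in (C). By `exists_resonance` it has a root `ζ₀` with `κ < h ζ₀`,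
and by `resonance_sign` its sign changes there, so `exists_common_zero` gives an exact solution for
small `α`.

For stability, the derivative in beam coordinates is a product of `flight` matrices
(`hasFDerivAt_billiardMap`). Seen from the caustic, an arc acts as one thin lens (`flight_arc`), so
the trace is explicit (`abs_trace_lt_two`). In the limit the two halves of the orbit have equal
matrices `N`, so the trace is `(tr N)² - 2` with `|tr N| = |8 n + 6 - 4 (2 n + 2) h ζ₀|`. The orbit
is elliptic because `κ < h ζ₀ < 1` and `h ζ₀ ≠ (2 n + 3/2) / (2 n + 2)`; these strict inequalities
persist for small `α` (`eventually_orbitCondition`). -/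

/-! ### Billiards in a general table with non-negative continuous curvature -/

/-- Tangent angle `θ` and curvature `κ` of a closed convex curve of perimeter `ℓ`. -/
structure ConvexTable (θ κ : ℝ → ℝ) (ℓ : ℝ) : Prop where
  deriv : ∀ s, HasDerivAt θ (κ s) s
  cont : Continuous κ
  nonneg : ∀ s, 0 ≤ κ s
  turn : ∀ s, θ (s + ℓ) = θ s + 2 * Real.pi
  closed : ∀ s, boundaryCurve θ (s + ℓ) = boundaryCurve θ s

theorem unitVec_re (x : ℝ) : (unitVec x).re = Real.cos x := Complex.exp_ofReal_mul_I_re x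

theorem unitVec_im (x : ℝ) : (unitVec x).im = Real.sin x := Complex.exp_ofReal_mul_I_im x

theorem continuous_unitVec : Continuous unitVec := by
  unfold unitVec; fun_prop

theorem hasDerivAt_boundaryCurve {θ : ℝ → ℝ} (hθ : Continuous θ) (s : ℝ) :
    HasDerivAt (boundaryCurve θ) (unitVec (θ s)) s :=
  (continuous_unitVec.comp hθ).integral_hasStrictDerivAt 0 s |>.hasDerivAt

theorem hasStrictDerivAt_boundaryCurve_re {θ : ℝ → ℝ} (hθ : Continuous θ) (s : ℝ) :
    HasStrictDerivAt (fun t => (boundaryCurve θ t).re) (Real.cos (θ s)) s := by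
  have h := (continuous_unitVec.comp hθ).integral_hasStrictDerivAt 0 s
  have := (Complex.reCLM.hasStrictFDerivAt (x := boundaryCurve θ s)).comp_hasStrictDerivAt s h
  exact this.congr_deriv (unitVec_re _)

theorem hasStrictDerivAt_boundaryCurve_im {θ : ℝ → ℝ} (hθ : Continuous θ) (s : ℝ) :
    HasStrictDerivAt (fun t => (boundaryCurve θ t).im) (Real.sin (θ s)) s := by
  have h := (continuous_unitVec.comp hθ).integral_hasStrictDerivAt 0 s
  have := (Complex.imCLM.hasStrictFDerivAt (x := boundaryCurve θ s)).comp_hasStrictDerivAt s h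
  exact this.congr_deriv (unitVec_im _)

/-- The component of `γ b - γ a` orthogonal to the direction of angle `ω`. -/
theorem boundaryCurve_cross {θ : ℝ → ℝ} (hθ : Continuous θ) (a b ω : ℝ) :
    Real.cos ω * ((boundaryCurve θ b).im - (boundaryCurve θ a).im)
      - Real.sin ω * ((boundaryCurve θ b).re - (boundaryCurve θ a).re)
      = ∫ u in a..b, Real.sin (θ u - ω) := by
  have hd : ∀ x ∈ uIcc a b, HasDerivAt (fun t => Real.cos ω * (boundaryCurve θ t).im
      - Real.sin ω * (boundaryCurve θ t).re) (Real.sin (θ x - ω)) x := by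
    intro x _
    have := ((hasStrictDerivAt_boundaryCurve_im hθ x).hasDerivAt.const_mul (Real.cos ω)).sub
      ((hasStrictDerivAt_boundaryCurve_re hθ x).hasDerivAt.const_mul (Real.sin ω))
    refine this.congr_deriv ?_
    rw [Real.sin_sub]; ring
  rw [intervalIntegral.integral_eq_sub_of_hasDerivAt hd
    ((Real.continuous_sin.comp (hθ.sub continuous_const)).intervalIntegrable _ _)]
  ring

/-- A chord of length `τ` of the table followed by a specular reflection. -/
def IsChord (θ : ℝ → ℝ) (ℓ τ : ℝ) (z w : ℝ × ℝ) : Prop :=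
  |z.2| < Real.pi / 2 ∧ |w.2| < Real.pi / 2 ∧ z.1 < w.1 ∧ w.1 < z.1 + ℓ ∧ 0 < τ ∧
    boundaryCurve θ w.1 = boundaryCurve θ z.1 + (τ : ℂ) * velocity θ z ∧
    w.2 = Real.pi - θ w.1 + θ z.1 - z.2

theorem velocity_reflect (θ : ℝ → ℝ) (z w : ℝ × ℝ)
    (h : w.2 = Real.pi - θ w.1 + θ z.1 - z.2) :
    velocity θ w = velocity θ z
      - ((2 * inner ℝ (velocity θ z) (innerNormal θ w.1) : ℝ) : ℂ) * innerNormal θ w.1 := by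
  have e1 : θ w.1 + Real.pi / 2 - w.2
      = 2 * (θ w.1 + Real.pi / 2) - (θ z.1 + Real.pi / 2 - z.2) - Real.pi := by rw [h]; ring
  unfold velocity innerNormal
  rw [e1]
  set ω := θ z.1 + Real.pi / 2 - z.2
  set ν := θ w.1 + Real.pi / 2
  have hs := Real.sin_sq_add_cos_sq ν
  apply Complex.ext
  · simp only [unitVec_re, unitVec_im, Complex.sub_re, Complex.mul_re, Complex.ofReal_re,
      Complex.ofReal_im, Complex.inner, Complex.conj_re, Complex.conj_im,
      Real.cos_sub_pi]
    simp only [Real.cos_sub, Real.cos_two_mul, Real.sin_two_mul]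
    ring
  · simp only [unitVec_re, unitVec_im, Complex.sub_im, Complex.mul_im, Complex.ofReal_re,
      Complex.ofReal_im, Complex.inner, Complex.mul_re, Complex.conj_re, Complex.conj_im,
      Real.sin_sub_pi]
    simp only [Real.sin_sub, Real.cos_two_mul, Real.sin_two_mul]
    linear_combination (2 * Real.sin ω) * hs

theorem IsChord.isNextCollision {θ : ℝ → ℝ} {ℓ τ : ℝ} {z w : ℝ × ℝ} (h : IsChord θ ℓ τ z w) :
    IsNextCollision θ ℓ z w := by
  obtain ⟨h1, h2, h3, h4, h5, h6, h7⟩ := h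
  exact ⟨h1, h2, h3, h4, ⟨τ, h5, h6⟩, velocity_reflect θ z w h7⟩

theorem eq_of_unitVec_eq {x y : ℝ} (h : unitVec x = unitVec y) (hxy : |x - y| < Real.pi) :
    x = y := by
  have hc : Real.cos (x - y) = 1 := by
    have h1 := congrArg Complex.re h
    have h2 := congrArg Complex.im h
    rw [unitVec_re, unitVec_re] at h1
    rw [unitVec_im, unitVec_im] at h2
    rw [Real.cos_sub, h1, h2]
    nlinarith [Real.sin_sq_add_cos_sq y]
  rw [abs_lt] at hxy
  have := (Real.cos_eq_one_iff_of_lt_of_lt (by linarith [Real.pi_pos]) (by linarith [Real.pi_pos])).1 hc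
  linarith

namespace ConvexTable

variable {θ κ : ℝ → ℝ} {ℓ : ℝ}

theorem continuous (T : ConvexTable θ κ ℓ) : Continuous θ :=
  continuous_iff_continuousAt.2 fun s => (T.deriv s).continuousAt

theorem monotone (T : ConvexTable θ κ ℓ) : Monotone θ :=
  monotone_of_hasDerivAt_nonneg T.deriv T.nonneg

theorem hasStrictDerivAt (T : ConvexTable θ κ ℓ) (s : ℝ) : HasStrictDerivAt θ (κ s) s :=
  hasStrictDerivAt_of_hasDerivAt_of_continuousAt (Filter.Eventually.of_forall T.deriv)
    T.cont.continuousAt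

/-- A line through a boundary point that is transversal to the curve meets it in only one more
point. -/
theorem eq_of_cross_eq_zero (T : ConvexTable θ κ ℓ) {s φ a b : ℝ} (hφ : |φ| < Real.pi / 2)
    (hsa : s < a) (hab : a < b) (hb : b < s + ℓ)
    (ha0 : ∫ u in s..a, Real.sin (θ u - (θ s + Real.pi / 2 - φ)) = 0)
    (hb0 : ∫ u in s..b, Real.sin (θ u - (θ s + Real.pi / 2 - φ)) = 0) : False := by
  obtain ⟨hφ1, hφ2⟩ := abs_lt.1 hφ
  set ω := θ s + Real.pi / 2 - φ with hω
  have hc : Continuous fun u => Real.sin (θ u - ω) :=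
    Real.continuous_sin.comp (T.continuous.sub continuous_const)
  have hi : ∀ x y : ℝ, IntervalIntegrable (fun u => Real.sin (θ u - ω)) volume x y :=
    fun x y => hc.intervalIntegrable x y
  have hend : ∫ u in s..(s + ℓ), Real.sin (θ u - ω) = 0 := by
    rw [← boundaryCurve_cross T.continuous, T.closed s]; ring
  have htop : θ (s + ℓ) - ω = φ + 3 * Real.pi / 2 := by rw [T.turn, hω]; ring
  have hbot : θ s - ω = φ - Real.pi / 2 := by rw [hω]; ring
  -- The integral over `[s, x]` is the signed distance of the boundary point `x` from the line; it
  -- vanishes at `s`, `a`, `b` and `s + ℓ`. The angle `θ - ω` increases from `φ - π/2` to `φ +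
  -- 3π/2`, so the integrand is nonpositive, nonnegative and nonpositive in turn. A zero at `a`
  -- needs the first phase to be over, zeros at `b` and `s + ℓ` need the last one not to have begun
  -- at `b`, and between `a` and `b` the distance then strictly increases.
  have ha : 0 < θ a - ω := by
    by_contra! hle
    have hpos : 0 < ∫ u in s..a, -Real.sin (θ u - ω) := by
      refine intervalIntegral.integral_pos hsa hc.neg.continuousOn (fun x hx => ?_)
        ⟨s, left_mem_Icc.2 hsa.le, ?_⟩
      · have h1 := T.monotone hx.1.le
        have h2 := T.monotone hx.2
        have := Real.sin_nonpos_of_nonpos_of_neg_pi_le (x := θ x - ω) (by linarith) (by linarith)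
        linarith
      · have := Real.sin_neg_of_neg_of_neg_pi_lt (x := θ s - ω) (by linarith) (by linarith)
        linarith
    rw [intervalIntegral.integral_neg, ha0] at hpos
    simp at hpos
  have hb' : θ b - ω < Real.pi := by
    by_contra! hle
    have hz : ∫ u in b..(s + ℓ), Real.sin (θ u - ω) = 0 := by
      have := intervalIntegral.integral_add_adjacent_intervals (hi s b) (hi b (s + ℓ))
      linarith
    have hpos : 0 < ∫ u in b..(s + ℓ), -Real.sin (θ u - ω) := by
      refine intervalIntegral.integral_pos hb hc.neg.continuousOn (fun x hx => ?_)
        ⟨s + ℓ, right_mem_Icc.2 hb.le, ?_⟩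
      · have h1 := T.monotone hx.1.le
        have h2 := T.monotone hx.2
        have := Real.sin_nonneg_of_nonneg_of_le_pi (x := θ x - ω - Real.pi)
          (by linarith) (by linarith)
        rw [Real.sin_sub_pi] at this
        linarith
      · have := Real.sin_pos_of_pos_of_lt_pi (x := θ (s + ℓ) - ω - Real.pi)
          (by linarith) (by linarith)
        rw [Real.sin_sub_pi] at this
        linarith
    rw [intervalIntegral.integral_neg, hz] at hpos
    simp at hpos
  have hz : ∫ u in a..b, Real.sin (θ u - ω) = 0 := by
    have := intervalIntegral.integral_add_adjacent_intervals (hi s a) (hi a b)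
    linarith
  have hpos : 0 < ∫ u in a..b, Real.sin (θ u - ω) := by
    refine intervalIntegral.intervalIntegral_pos_of_pos_on (hi a b) (fun x hx => ?_) hab
    have h1 := T.monotone hx.1.le
    have h2 := T.monotone hx.2.le
    exact Real.sin_pos_of_pos_of_lt_pi (by linarith) (by linarith)
  linarith

/-- Convexity makes the choice in `billiardMap` harmless: both candidates lie on the same
transversal line, hence agree as boundary points, and equal velocities then force equal angles,
which differ by less than `π`. -/
theorem isNextCollision_unique (T : ConvexTable θ κ ℓ) {z w w' : ℝ × ℝ}
    (h : IsNextCollision θ ℓ z w) (h' : IsNextCollision θ ℓ z w') : w = w' := by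
  have cross : ∀ v : ℝ × ℝ, IsNextCollision θ ℓ z v →
      ∫ u in z.1..v.1, Real.sin (θ u - (θ z.1 + Real.pi / 2 - z.2)) = 0 := by
    rintro v ⟨-, -, -, -, ⟨τ, -, hτ⟩, -⟩
    rw [← boundaryCurve_cross T.continuous, hτ]
    simp only [velocity, Complex.add_im, Complex.add_re, Complex.mul_im, Complex.mul_re,
      Complex.ofReal_re, Complex.ofReal_im, unitVec_re, unitVec_im]
    ring
  have h1 : w.1 = w'.1 := by
    rcases lt_trichotomy w.1 w'.1 with hlt | heq | hgt
    · exact (T.eq_of_cross_eq_zero h.1 h.2.2.1 hlt h'.2.2.2.1 (cross w h) (cross w' h')).elim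
    · exact heq
    · exact (T.eq_of_cross_eq_zero h.1 h'.2.2.1 hgt h.2.2.2.1 (cross w' h') (cross w h)).elim
  have hv : velocity θ w = velocity θ w' := by
    rw [h.2.2.2.2.2, h'.2.2.2.2.2, h1]
  have a1 := abs_lt.1 h.2.1
  have a2 := abs_lt.1 h'.2.1
  have h2 := eq_of_unitVec_eq hv (by
    rw [h1, abs_lt]; constructor <;> linarith)
  rw [h1] at h2
  exact Prod.ext h1 (by linarith)

theorem billiardMap_eq (T : ConvexTable θ κ ℓ) {τ : ℝ} {z w : ℝ × ℝ} (h : IsChord θ ℓ τ z w) :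
    billiardMap θ ℓ z = w := by
  have hex : ∃ v, IsNextCollision θ ℓ z v := ⟨w, h.isNextCollision⟩
  rw [billiardMap, dif_pos hex]
  exact T.isNextCollision_unique hex.choose_spec h.isNextCollision

end ConvexTable

/-! ### The derivative of the billiard map -/

/-- The continuous linear map of the plane with a given matrix. -/
noncomputable def planeMap (A : Matrix (Fin 2) (Fin 2) ℝ) : (ℝ × ℝ) →L[ℝ] (ℝ × ℝ) :=
  LinearMap.toContinuousLinearMap
    (Matrix.toLin (Module.Basis.finTwoProd ℝ) (Module.Basis.finTwoProd ℝ) A)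

theorem planeMap_apply (A : Matrix (Fin 2) (Fin 2) ℝ) (v : ℝ × ℝ) :
    planeMap A v = (A 0 0 * v.1 + A 0 1 * v.2, A 1 0 * v.1 + A 1 1 * v.2) := by
  rw [planeMap, LinearMap.coe_toContinuousLinearMap']
  conv_lhs => rw [Matrix.eta_fin_two A]
  rw [Matrix.toLin_finTwoProd_apply]

theorem planeMap_mul (A B : Matrix (Fin 2) (Fin 2) ℝ) :
    planeMap (A * B) = (planeMap A).comp (planeMap B) := by
  ext <;> simp [planeMap_apply, Matrix.mul_apply, Fin.sum_univ_two]

theorem det_planeMap (A : Matrix (Fin 2) (Fin 2) ℝ) : (planeMap A).det = A.det := by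
  simp [planeMap, ContinuousLinearMap.det, LinearMap.det_toLin]

theorem trace_planeMap (A : Matrix (Fin 2) (Fin 2) ℝ) :
    LinearMap.trace ℝ (ℝ × ℝ) (planeMap A).toLinearMap = A.trace := by
  simp only [planeMap, LinearMap.coe_toContinuousLinearMap]
  rw [LinearMap.trace_eq_matrix_trace ℝ (Module.Basis.finTwoProd ℝ), LinearMap.toMatrix_toLin]

/-- The coordinates `(cos φ ds, κ ds - dφ)` on the outgoing beams at a point of the phase space. -/
noncomputable def beamFrame (κ : ℝ → ℝ) (z : ℝ × ℝ) : Matrix (Fin 2) (Fin 2) ℝ :=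
  !![Real.cos z.2, 0; κ z.1, -1]

/-- Free flight of length `τ`, followed by a reflection of strength `g`. -/
def flight (τ g : ℝ) : Matrix (Fin 2) (Fin 2) ℝ := !![-1, τ; -g, g * τ - 1]

theorem IsChord.diff {θ : ℝ → ℝ} {ℓ τ : ℝ} {z w : ℝ × ℝ} (h : IsChord θ ℓ τ z w) :
    (boundaryCurve θ w.1).re - (boundaryCurve θ z.1).re
        = τ * Real.cos (θ z.1 + Real.pi / 2 - z.2) ∧
      (boundaryCurve θ w.1).im - (boundaryCurve θ z.1).im
        = τ * Real.sin (θ z.1 + Real.pi / 2 - z.2) := by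
  obtain ⟨-, -, -, -, -, h6, -⟩ := h
  rw [h6]
  simp only [velocity, Complex.add_im, Complex.add_re, Complex.mul_im, Complex.mul_re,
      Complex.ofReal_re, Complex.ofReal_im, unitVec_re, unitVec_im]
  constructor <;> ring

/-- Crossing function: vanishes when the ray leaving `v.1` passes through the boundary point with
parameter `v.2`. -/
noncomputable def rayCross (θ : ℝ → ℝ) (v : (ℝ × ℝ) × ℝ) : ℝ :=
  Real.cos (θ v.1.1 + Real.pi / 2 - v.1.2)
      * ((boundaryCurve θ v.2).im - (boundaryCurve θ v.1.1).im)
    - Real.sin (θ v.1.1 + Real.pi / 2 - v.1.2)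
      * ((boundaryCurve θ v.2).re - (boundaryCurve θ v.1.1).re)

namespace ConvexTable

variable {θ κ : ℝ → ℝ} {ℓ : ℝ}

/-- The last coefficient is the cosine of the incidence angle at the target. It is nonzero, which is
what the implicit function theorem needs to follow the point of impact. -/
theorem hasStrictFDerivAt_rayCross (T : ConvexTable θ κ ℓ) {τ : ℝ} {z w : ℝ × ℝ}
    (h : IsChord θ ℓ τ z w) :
    HasStrictFDerivAt (rayCross θ)
      ((Real.cos z.2 - τ * κ z.1) • (ContinuousLinearMap.fst ℝ ℝ ℝ).comp
          (ContinuousLinearMap.fst ℝ (ℝ × ℝ) ℝ)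
        + τ • (ContinuousLinearMap.snd ℝ ℝ ℝ).comp (ContinuousLinearMap.fst ℝ (ℝ × ℝ) ℝ)
        + Real.cos w.2 • ContinuousLinearMap.snd ℝ (ℝ × ℝ) ℝ) (z, w.1) := by
  have p1 : HasStrictFDerivAt (fun v : (ℝ × ℝ) × ℝ => v.1.1)
      ((ContinuousLinearMap.fst ℝ ℝ ℝ).comp (ContinuousLinearMap.fst ℝ (ℝ × ℝ) ℝ)) (z, w.1) :=
    ((ContinuousLinearMap.fst ℝ ℝ ℝ).comp
      (ContinuousLinearMap.fst ℝ (ℝ × ℝ) ℝ)).hasStrictFDerivAt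
  have p2 : HasStrictFDerivAt (fun v : (ℝ × ℝ) × ℝ => v.1.2)
      ((ContinuousLinearMap.snd ℝ ℝ ℝ).comp (ContinuousLinearMap.fst ℝ (ℝ × ℝ) ℝ)) (z, w.1) :=
    ((ContinuousLinearMap.snd ℝ ℝ ℝ).comp
      (ContinuousLinearMap.fst ℝ (ℝ × ℝ) ℝ)).hasStrictFDerivAt
  have p3 : HasStrictFDerivAt (fun v : (ℝ × ℝ) × ℝ => v.2)
      (ContinuousLinearMap.snd ℝ (ℝ × ℝ) ℝ) (z, w.1) :=
    (ContinuousLinearMap.snd ℝ (ℝ × ℝ) ℝ).hasStrictFDerivAt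
  have hω := (((T.hasStrictDerivAt z.1).comp_hasStrictFDerivAt (z, w.1) p1).add_const
    (Real.pi / 2)).sub p2
  have hc := T.continuous
  have hy := ((hasStrictDerivAt_boundaryCurve_im hc w.1).comp_hasStrictFDerivAt (z, w.1) p3).sub
    ((hasStrictDerivAt_boundaryCurve_im hc z.1).comp_hasStrictFDerivAt (z, w.1) p1)
  have hx := ((hasStrictDerivAt_boundaryCurve_re hc w.1).comp_hasStrictFDerivAt (z, w.1) p3).sub
    ((hasStrictDerivAt_boundaryCurve_re hc z.1).comp_hasStrictFDerivAt (z, w.1) p1)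
  have hF := (hω.cos.mul hy).sub (hω.sin.mul hx)
  refine hF.congr_fderiv ?_
  obtain ⟨dx, dy⟩ := h.diff
  have e1 : Real.cos w.2 = Real.sin (θ w.1 - (θ z.1 + Real.pi / 2 - z.2)) := by
    rw [h.2.2.2.2.2.2, ← Real.sin_pi_div_two_sub]; congr 1; ring
  have e2 : Real.cos z.2 = -Real.sin (θ z.1 - (θ z.1 + Real.pi / 2 - z.2)) := by
    rw [← Real.sin_neg, ← Real.sin_pi_div_two_sub]; congr 1; ring
  rw [e1, e2]
  simp only [Function.comp, Pi.sub_apply] at *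
  rw [dx, dy]
  set ω := θ z.1 + Real.pi / 2 - z.2
  have hs := Real.sin_sq_add_cos_sq ω
  simp only [Real.sin_sub]
  refine ContinuousLinearMap.ext fun v => ?_
  simp
  linear_combination (-τ * (κ z.1 * v.1.1 - v.1.2)) * hs

/-- Matrix of the derivative of the billiard map along a chord, in the coordinates `(s, φ)`. -/
theorem hasFDerivAt_billiardMap (T : ConvexTable θ κ ℓ) {τ : ℝ} {z w : ℝ × ℝ}
    (h : IsChord θ ℓ τ z w) :
    ∃ A, HasFDerivAt (billiardMap θ ℓ) (planeMap A) z ∧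
      beamFrame κ w * A = flight τ (2 * κ w.1 / Real.cos w.2) * beamFrame κ z := by
  have hcw : 0 < Real.cos w.2 := Real.cos_pos_of_mem_Ioo (abs_lt.1 h.2.1)
  have hF := T.hasStrictFDerivAt_rayCross h
  have hinv : ((((Real.cos z.2 - τ * κ z.1) • (ContinuousLinearMap.fst ℝ ℝ ℝ).comp
          (ContinuousLinearMap.fst ℝ (ℝ × ℝ) ℝ)
        + τ • (ContinuousLinearMap.snd ℝ ℝ ℝ).comp (ContinuousLinearMap.fst ℝ (ℝ × ℝ) ℝ)
        + Real.cos w.2 • ContinuousLinearMap.snd ℝ (ℝ × ℝ) ℝ)) ∘L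
          .inr ℝ (ℝ × ℝ) ℝ).IsInvertible := by
    refine ⟨ContinuousLinearEquiv.unitsEquivAut ℝ (Units.mk0 _ hcw.ne'), ?_⟩
    ext; simp [ContinuousLinearEquiv.unitsEquivAut]
  have hS := hF.hasStrictFDerivAt_implicitFunctionOfProdDomain hinv
  have hSt := hF.tendsto_implicitFunctionOfProdDomain hinv
  have hSe := hF.eventually_apply_implicitFunctionOfProdDomain hinv
  set S := hF.implicitFunctionOfProdDomain hinv
  simp only at hS hSt hSe
  obtain ⟨dx, dy⟩ := h.diff
  have hz0 : rayCross θ (z, w.1) = 0 := by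
    simp only [rayCross]; rw [dx, dy]; ring
  have hSz : S z = w.1 := by
    have := hS.continuousAt.tendsto
    exact tendsto_nhds_unique this hSt
  -- The derivative of `S` is read off by differentiating the identity `rayCross θ (x, S x) = 0`.
  have hSd : HasFDerivAt S (((τ * κ z.1 - Real.cos z.2) / Real.cos w.2) •
      ContinuousLinearMap.fst ℝ ℝ ℝ + (-τ / Real.cos w.2) • ContinuousLinearMap.snd ℝ ℝ ℝ) z := by
    have hFS : HasFDerivAt (fun x => rayCross θ (x, S x)) (0 : ℝ × ℝ →L[ℝ] ℝ) z := by
      refine (hasFDerivAt_const (rayCross θ (z, w.1)) z).congr_of_eventuallyEq ?_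
      exact hSe
    have hFz := hF.hasFDerivAt
    rw [← hSz] at hFz
    have hcomp := hFz.comp z ((hasFDerivAt_id z).prodMk hS.hasFDerivAt)
    have huniq := hFS.unique hcomp
    refine hS.hasFDerivAt.congr_fderiv ?_
    refine ContinuousLinearMap.ext fun v => ?_
    have := congrArg (fun l : ℝ × ℝ →L[ℝ] ℝ => l v) huniq
    simp only [ContinuousLinearMap.comp_apply, add_apply,
      smul_apply, ContinuousLinearMap.prod_apply,
      ContinuousLinearMap.coe_fst', ContinuousLinearMap.coe_snd', smul_eq_mul,
      zero_apply, ContinuousLinearMap.id_apply] at this ⊢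
    field_simp
    linear_combination -this
  have hθz : HasFDerivAt (fun x : ℝ × ℝ => θ x.1) (κ z.1 • ContinuousLinearMap.fst ℝ ℝ ℝ) z :=
    (T.deriv z.1).comp_hasFDerivAt z hasFDerivAt_fst
  have hθS := (show HasDerivAt θ (κ w.1) (S z) by rw [hSz]; exact T.deriv w.1).comp_hasFDerivAt z hSd
  have hΦ := ((hθS.const_sub Real.pi).add hθz).sub
    (hasFDerivAt_snd : HasFDerivAt (Prod.snd : ℝ × ℝ → ℝ) _ z)
  have hG := hSd.prodMk hΦ
  -- Apart from the crossing equation, which `S` solves identically, and the reflection law, which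
  -- is built in, a chord is defined by strict inequalities. They persist near `z`, so the explicit
  -- map agrees there with `billiardMap`.
  have hchord : ∀ᶠ x in nhds z, ∃ τ', IsChord θ ℓ τ' x
      (S x, Real.pi - θ (S x) + θ x.1 - x.2) := by
    have hc := T.continuous
    have cS : ContinuousAt S z := hSd.continuousAt
    have c1 : ContinuousAt (fun x : ℝ × ℝ => x.1) z := continuous_fst.continuousAt
    have c2 : ContinuousAt (fun x : ℝ × ℝ => x.2) z := continuous_snd.continuousAt
    have cθS : ContinuousAt (fun x => θ (S x)) z := hc.continuousAt.comp cS
    have cφ : ContinuousAt (fun x : ℝ × ℝ => Real.pi - θ (S x) + θ x.1 - x.2) z :=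
      ((continuousAt_const.sub cθS).add (hc.continuousAt.comp c1)).sub c2
    have cω : ContinuousAt (fun x : ℝ × ℝ => θ x.1 + Real.pi / 2 - x.2) z :=
      ((hc.continuousAt.comp c1).add continuousAt_const).sub c2
    have hre : Continuous fun t => (boundaryCurve θ t).re := continuous_iff_continuousAt.2
      fun s => (hasStrictDerivAt_boundaryCurve_re hc s).hasDerivAt.continuousAt
    have him : Continuous fun t => (boundaryCurve θ t).im := continuous_iff_continuousAt.2
      fun s => (hasStrictDerivAt_boundaryCurve_im hc s).hasDerivAt.continuousAt
    -- The chord length as the projection of the displacement onto the ray; its positivity excludes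
    -- the backward half of the line.
    set t : ℝ × ℝ → ℝ := fun x =>
      Real.cos (θ x.1 + Real.pi / 2 - x.2) * ((boundaryCurve θ (S x)).re - (boundaryCurve θ x.1).re)
      + Real.sin (θ x.1 + Real.pi / 2 - x.2)
        * ((boundaryCurve θ (S x)).im - (boundaryCurve θ x.1).im) with ht
    have ct : ContinuousAt t z :=
      ((Real.continuous_cos.continuousAt.comp cω).mul
        ((hre.continuousAt.comp cS).sub (hre.continuousAt.comp c1))).add
      ((Real.continuous_sin.continuousAt.comp cω).mul
        ((him.continuousAt.comp cS).sub (him.continuousAt.comp c1)))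
    have htz : t z = τ := by
      simp only [ht, hSz]
      rw [dx, dy]
      linear_combination τ * Real.sin_sq_add_cos_sq (θ z.1 + Real.pi / 2 - z.2)
    have k1 : ∀ᶠ x in nhds z, |x.2| < Real.pi / 2 :=
      c2.abs.eventually_lt continuousAt_const h.1
    have k2 : ∀ᶠ x in nhds z, |Real.pi - θ (S x) + θ x.1 - x.2| < Real.pi / 2 := by
      refine cφ.abs.eventually_lt continuousAt_const ?_
      rw [hSz, ← h.2.2.2.2.2.2]; exact h.2.1
    have k3 : ∀ᶠ x in nhds z, x.1 < S x := by
      refine c1.eventually_lt cS ?_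
      rw [hSz]; exact h.2.2.1
    have k4 : ∀ᶠ x in nhds z, S x < x.1 + ℓ := by
      refine cS.eventually_lt (c1.add continuousAt_const) ?_
      rw [hSz]; exact h.2.2.2.1
    have k5 : ∀ᶠ x in nhds z, 0 < t x := by
      refine continuousAt_const.eventually_lt ct ?_
      rw [htz]; exact h.2.2.2.2.1
    filter_upwards [k1, k2, k3, k4, k5, hSe] with x h1 h2 h3 h4 h5 h6
    refine ⟨t x, h1, h2, h3, h4, h5, ?_, rfl⟩
    rw [hz0] at h6
    simp only [rayCross] at h6
    have hs := Real.sin_sq_add_cos_sq (θ x.1 + Real.pi / 2 - x.2)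
    apply Complex.ext
    · simp only [velocity, Complex.add_re, Complex.mul_re,
        Complex.ofReal_re, Complex.ofReal_im, unitVec_re, unitVec_im, ht]
      linear_combination (-Real.sin (θ x.1 + Real.pi / 2 - x.2)) * h6
        - ((boundaryCurve θ (S x)).re - (boundaryCurve θ x.1).re) * hs
    · simp only [velocity, Complex.add_im, Complex.mul_im,
        Complex.ofReal_re, Complex.ofReal_im, unitVec_re, unitVec_im, ht]
      linear_combination (Real.cos (θ x.1 + Real.pi / 2 - x.2)) * h6
        - ((boundaryCurve θ (S x)).im - (boundaryCurve θ x.1).im) * hs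
  refine ⟨!![(τ * κ z.1 - Real.cos z.2) / Real.cos w.2, -τ / Real.cos w.2;
    κ z.1 - κ w.1 * ((τ * κ z.1 - Real.cos z.2) / Real.cos w.2),
    -1 - κ w.1 * (-τ / Real.cos w.2)], ?_, ?_⟩
  · have hB : HasFDerivAt (billiardMap θ ℓ) _ z := hG.congr_of_eventuallyEq <| by
      filter_upwards [hchord] with x hx
      obtain ⟨τ', hx⟩ := hx
      exact T.billiardMap_eq hx
    refine hB.congr_fderiv ?_
    refine ContinuousLinearMap.ext fun v => ?_
    rw [planeMap_apply]
    simp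
    ring
  · ext i j
    fin_cases i <;> fin_cases j <;>
      simp [beamFrame, flight, Matrix.mul_apply, Fin.sum_univ_two] <;> field_simp <;> ring

end ConvexTable

/-! ### Orbit segments and the trace of the return map -/

/-- The billiard orbit of `z` reaches `w` after `k` collisions, and the derivative of the `k`-th
iterate has the matrix `M` in beam coordinates. -/
structure OrbitSegment (θ κ : ℝ → ℝ) (ℓ : ℝ) (z w : ℝ × ℝ) (k : ℕ)
    (M : Matrix (Fin 2) (Fin 2) ℝ) : Prop where
  collide : ∀ i < k, IsNextCollision θ ℓ ((billiardMap θ ℓ)^[i] z) ((billiardMap θ ℓ)^[i + 1] z)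
  endpoint : (billiardMap θ ℓ)^[k] z = w
  deriv : ∃ A, HasFDerivAt ((billiardMap θ ℓ)^[k]) (planeMap A) z ∧
    beamFrame κ w * A = M * beamFrame κ z

namespace OrbitSegment

variable {θ κ : ℝ → ℝ} {ℓ : ℝ} {z w v : ℝ × ℝ} {k l : ℕ} {M N : Matrix (Fin 2) (Fin 2) ℝ}

theorem refl (θ κ : ℝ → ℝ) (ℓ : ℝ) (z : ℝ × ℝ) : OrbitSegment θ κ ℓ z z 0 1 := by
  refine ⟨by simp, rfl, 1, ?_, by simp⟩
  have : planeMap 1 = ContinuousLinearMap.id ℝ (ℝ × ℝ) := by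
    ext <;> simp [planeMap_apply]
  rw [this]
  exact hasFDerivAt_id z

theorem trans (h₁ : OrbitSegment θ κ ℓ z w k M) (h₂ : OrbitSegment θ κ ℓ w v l N) :
    OrbitSegment θ κ ℓ z v (k + l) (N * M) := by
  obtain ⟨c1, e1, A, dA, hA⟩ := h₁
  obtain ⟨c2, e2, B, dB, hB⟩ := h₂
  have hsplit : ∀ j, (billiardMap θ ℓ)^[j + k] z = (billiardMap θ ℓ)^[j] w := fun j => by
    rw [Function.iterate_add_apply, e1]
  refine ⟨fun i hi => ?_, ?_, B * A, ?_, ?_⟩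
  · rcases lt_or_ge i k with h | h
    · exact c1 i h
    · obtain ⟨j, rfl⟩ := Nat.exists_eq_add_of_le' h
      have := c2 j (by omega)
      rw [← hsplit, ← hsplit] at this
      rwa [show j + k + 1 = j + 1 + k by ring]
  · rw [add_comm, hsplit, e2]
  · rw [add_comm k l, Function.iterate_add, planeMap_mul]
    rw [← e1] at dB
    exact dB.comp z dA
  · rw [← mul_assoc, hB, mul_assoc, hA, mul_assoc]

theorem ofChord (T : ConvexTable θ κ ℓ) {τ : ℝ} (h : IsChord θ ℓ τ z w) :
    OrbitSegment θ κ ℓ z w 1 (flight τ (2 * κ w.1 / Real.cos w.2)) := by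
  refine ⟨fun i hi => ?_, ?_, ?_⟩
  · obtain rfl : i = 0 := by omega
    simpa [T.billiardMap_eq h] using h.isNextCollision
  · simpa using T.billiardMap_eq h
  · simpa using T.hasFDerivAt_billiardMap h

theorem ofChords (T : ConvexTable θ κ ℓ) {τ g : ℝ} (p : ℕ → ℝ × ℝ) (k : ℕ)
    (h : ∀ j < k, IsChord θ ℓ τ (p j) (p (j + 1)))
    (hg : ∀ j < k, 2 * κ (p (j + 1)).1 / Real.cos (p (j + 1)).2 = g) :
    OrbitSegment θ κ ℓ (p 0) (p k) k (flight τ g ^ k) := by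
  induction k with
  | zero => simpa using refl θ κ ℓ (p 0)
  | succ k ih =>
    have h1 := ih (fun j hj => h j (by omega)) (fun j hj => hg j (by omega))
    have h2 := ofChord T (h k (by omega))
    rw [hg k (by omega)] at h2
    rw [pow_succ']
    exact h1.trans h2

/-- After one turn the beam frame is the same as at the start, and it is invertible since `cos φ >
0`. The derivative is therefore conjugate to `M`. -/
theorem hasEllipticPeriodicOrbit (h : OrbitSegment θ κ ℓ z (z.1 + ℓ, z.2) k M) (hk : 0 < k)
    (hκ : κ (z.1 + ℓ) = κ z.1) (hdet : M.det = 1) (htr : |M.trace| < 2) :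
    HasEllipticPeriodicOrbit θ ℓ := by
  obtain ⟨c, e, A, dA, hA⟩ := h
  have hframe : beamFrame κ (z.1 + ℓ, z.2) = beamFrame κ z := by simp [beamFrame, hκ]
  rw [hframe] at hA
  have hz : |z.2| < Real.pi / 2 := (c 0 hk).1
  have hu : IsUnit (beamFrame κ z).det := by
    have := Real.cos_pos_of_mem_Ioo (abs_lt.1 hz)
    simp [beamFrame, Matrix.det_fin_two, this.ne']
  have hAM : A = (beamFrame κ z)⁻¹ * (M * beamFrame κ z) := by
    rw [← hA, Matrix.nonsing_inv_mul_cancel_left _ _ hu]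
  refine ⟨k, z, hk, c, ⟨1, by rw [e]; simp⟩, planeMap A, dA, ?_, ?_⟩
  · have := congrArg Matrix.det hA
    rw [Matrix.det_mul, Matrix.det_mul, hdet, one_mul] at this
    rw [det_planeMap]
    exact mul_left_cancel₀ hu.ne_zero (by rw [this, mul_one])
  · rw [trace_planeMap, hAM, Matrix.trace_mul_comm, mul_assoc,
      Matrix.mul_nonsing_inv _ hu, mul_one]
    exact htr

end OrbitSegment

theorem det_flight (τ g : ℝ) : (flight τ g).det = 1 := by
  simp [flight, Matrix.det_fin_two]; ring

/-- Successive reflections on a circular arc, with half chord length `r`. -/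
theorem flight_circle_pow {r : ℝ} (hr : r ≠ 0) (k : ℕ) :
    flight (2 * r) (2 / r) ^ k
      = !![1 - 2 * (k : ℝ), 2 * k * r; -(2 * k / r), 1 + 2 * k] := by
  -- The matrix is the identity plus a matrix of square zero, so its powers are affine in `k`.
  induction k with
  | zero => ext i j; fin_cases i <;> fin_cases j <;> simp
  | succ k ih =>
    rw [pow_succ, ih]
    ext i j
    fin_cases i <;> fin_cases j <;>
      simp [flight, Matrix.mul_apply, Fin.sum_univ_two] <;> field_simp <;> ring

/-- Entries of the transfer matrix of a circular arc with `2 n + 1` reflections, half chord length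
`r`, between two points at distance `e` from the tangency points with the caustic. -/
noncomputable def arcDiag (n : ℕ) (r e : ℝ) : ℝ := 1 + e * ((2 * n + 1) * 2 / r)

/-- Upper right entry of the transfer matrix of a circular arc. -/
noncomputable def arcUpper (n : ℕ) (r e : ℝ) : ℝ := e * (2 + e * ((2 * n + 1) * 2 / r))

/-- Free flight `r`, reflection of strength `2 / r` and free flight `r` compose to a thin lens of
strength `2 / r` between consecutive points of tangency. Hence `2 n + 1` reflections form one lens
of strength `(2 n + 1) * 2 / r`, with a free flight `e` on either side, followed by the exceptional
reflection `g`. -/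
theorem flight_arc {r : ℝ} (hr : r ≠ 0) (n : ℕ) (e g : ℝ) :
    flight (e + r) g * (flight (2 * r) (2 / r) ^ (2 * n) * flight (e + r) (2 / r))
      = !![-arcDiag n r e, arcUpper n r e; (2 * n + 1) * 2 / r - g * arcDiag n r e,
        g * arcUpper n r e - arcDiag n r e] := by
  rw [flight_circle_pow hr]
  ext i j
  fin_cases i <;> fin_cases j <;>
    simp [flight, Matrix.mul_apply, Fin.sum_univ_two, arcDiag, arcUpper] <;> field_simp <;> ring

/-- The sum of the half traces of the two halves of the orbit, up to normalization. -/
noncomputable def returnTrace (n : ℕ) (r e r' e' g : ℝ) : ℝ :=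
  arcDiag n r e * arcUpper n r' e' + arcDiag n r' e' * arcUpper n r e
    - g * arcUpper n r e * arcUpper n r' e'

/-- A cyclic permutation splits the orbit at the exceptional collisions into two arc matrices. Write
`B`, `B'` for the two values of `arcUpper` and `R` for `returnTrace`. The unit determinant of the
lens blocks (`d1`, `d2`) turns the trace into `(R² - B² - B'²) / (B B')`, so modulus less than 2
means `(B - B')² < R² < (B + B')²`. -/
theorem abs_trace_lt_two {n : ℕ} {r e r' e' g : ℝ} (hr : 0 < r) (hr' : 0 < r') (he : 0 < e)
    (he' : 0 < e')
    (h1 : (arcUpper n r e - arcUpper n r' e') ^ 2 < returnTrace n r e r' e' g ^ 2)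
    (h2 : returnTrace n r e r' e' g ^ 2 < (arcUpper n r e + arcUpper n r' e') ^ 2) :
    |(flight (e + r) (2 / r) * (flight (e' + r') g * (flight (2 * r') (2 / r') ^ (2 * n)
      * (flight (e' + r') (2 / r') * (flight (e + r) g
        * flight (2 * r) (2 / r) ^ (2 * n)))))).trace| < 2 := by
  have hB : 0 < arcUpper n r e := by unfold arcUpper; positivity
  have hB' : 0 < arcUpper n r' e' := by unfold arcUpper; positivity
  rw [Matrix.trace_mul_comm]
  have hassoc : flight (e' + r') g * (flight (2 * r') (2 / r') ^ (2 * n)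
      * (flight (e' + r') (2 / r') * (flight (e + r) g * flight (2 * r) (2 / r) ^ (2 * n))))
      * flight (e + r) (2 / r)
      = (flight (e' + r') g * (flight (2 * r') (2 / r') ^ (2 * n) * flight (e' + r') (2 / r')))
        * (flight (e + r) g * (flight (2 * r) (2 / r) ^ (2 * n) * flight (e + r) (2 / r))) := by
    simp only [mul_assoc]
  have key : arcUpper n r e * arcUpper n r' e' *
      ((flight (e' + r') g * (flight (2 * r') (2 / r') ^ (2 * n) * flight (e' + r') (2 / r')))
        * (flight (e + r) g * (flight (2 * r) (2 / r) ^ (2 * n) * flight (e + r) (2 / r)))).trace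
      = returnTrace n r e r' e' g ^ 2 - arcUpper n r e ^ 2 - arcUpper n r' e' ^ 2 := by
    rw [flight_arc hr.ne', flight_arc hr'.ne']
    simp [Matrix.trace_fin_two]
    have d1 : arcDiag n r e ^ 2 - arcUpper n r e * ((2 * n + 1) * 2 / r) = 1 := by
      unfold arcDiag arcUpper; ring
    have d2 : arcDiag n r' e' ^ 2 - arcUpper n r' e' * ((2 * n + 1) * 2 / r') = 1 := by
      unfold arcDiag arcUpper; ring
    unfold returnTrace
    linear_combination (-arcUpper n r' e' ^ 2) * d1 - arcUpper n r e ^ 2 * d2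
  rw [hassoc]
  set t := ((flight (e' + r') g * (flight (2 * r') (2 / r') ^ (2 * n) * flight (e' + r') (2 / r')))
        * (flight (e + r) g * (flight (2 * r) (2 / r) ^ (2 * n) * flight (e + r) (2 / r)))).trace
  have hBB := mul_pos hB hB'
  rw [abs_lt]
  constructor
  · by_contra! hle
    nlinarith
  · by_contra! hle
    nlinarith

/-! ### Geometry of the stadium -/

/-- The assumptions on the shape function and on the parameters of the stadium. -/
structure StadiumData (h : ℝ → ℝ) (ρ α L : ℝ) : Prop where
  cont : ContinuousOn h (Icc 0 1)
  anti : AntitoneOn h (Icc 0 1)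
  zero : h 0 = 1
  one : h 1 = 0
  integral_pos : 0 < ∫ ξ in (0 : ℝ)..1, h ξ
  radius_pos : 0 < ρ
  angle_pos : 0 < α
  angle_lt : α < Real.pi / 2
  separation_nonneg : 0 ≤ L

/-- The shape function, extended by constants outside the unit interval. -/
noncomputable def shapeExt (h : ℝ → ℝ) (x : ℝ) : ℝ := h (max 0 (min x 1))

/-- Length of the half of the remaining circular arc. -/
noncomputable def arcEnd (ρ α : ℝ) : ℝ := ρ * (Real.pi / 2 - α)

theorem clamp_mem (x : ℝ) : max 0 (min x 1) ∈ Icc (0 : ℝ) 1 :=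
  ⟨le_max_left _ _, max_le zero_le_one (min_le_right _ _)⟩

theorem shapeExt_of_mem (h : ℝ → ℝ) {x : ℝ} (hx : x ∈ Icc (0 : ℝ) 1) : shapeExt h x = h x := by
  rw [shapeExt, min_eq_left hx.2, max_eq_right hx.1]

theorem eq_of_hasDerivAt_eq {f g f' : ℝ → ℂ} (hf : ∀ s, HasDerivAt f (f' s) s)
    (hg : ∀ s, HasDerivAt g (f' s) s) (h0 : f 0 = g 0) (s : ℝ) : f s = g s := by
  have hd : ∀ x, HasDerivAt (f - g) 0 x := fun x => by simpa using (hf x).sub (hg x)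
  have := is_const_of_deriv_eq_zero (fun x => (hd x).differentiableAt) (fun x => (hd x).deriv) s 0
  simp only [Pi.sub_apply, h0, sub_self] at this
  exact sub_eq_zero.1 this

theorem conj_unitVec (x : ℝ) : (starRingEnd ℂ) (unitVec x) = unitVec (-x) := by
  apply Complex.ext <;> simp [unitVec_re, unitVec_im]

theorem unitVec_add_pi (x : ℝ) : unitVec (x + Real.pi) = -unitVec x := by
  apply Complex.ext <;> simp [unitVec_re, unitVec_im]

namespace StadiumData

variable {h : ℝ → ℝ} {ρ α L : ℝ}

theorem continuous_shapeExt (D : StadiumData h ρ α L) : Continuous (shapeExt h) :=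
  D.cont.comp_continuous (by fun_prop) clamp_mem

theorem shapeExt_nonneg (D : StadiumData h ρ α L) (x : ℝ) : 0 ≤ shapeExt h x := by
  rw [← D.one]
  exact D.anti (clamp_mem x) (right_mem_Icc.2 zero_le_one) (clamp_mem x).2

theorem shapeExt_le_one (D : StadiumData h ρ α L) (x : ℝ) : shapeExt h x ≤ 1 := by
  rw [← D.zero]
  exact D.anti (left_mem_Icc.2 zero_le_one) (clamp_mem x) (clamp_mem x).1

theorem shapeExt_of_nonpos (D : StadiumData h ρ α L) {x : ℝ} (hx : x ≤ 0) : shapeExt h x = 1 := by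
  rw [shapeExt, max_eq_left ((min_le_left _ _).trans hx), D.zero]

theorem shapeExt_of_one_le (D : StadiumData h ρ α L) {x : ℝ} (hx : 1 ≤ x) : shapeExt h x = 0 := by
  rw [shapeExt, min_eq_right hx, max_eq_right zero_le_one, D.one]

theorem smoothenedLength_pos (D : StadiumData h ρ α L) : 0 < smoothenedLength h ρ α :=
  div_pos (mul_pos D.radius_pos D.angle_pos) D.integral_pos

theorem arcEnd_pos (D : StadiumData h ρ α L) : 0 < arcEnd ρ α :=
  mul_pos D.radius_pos (sub_pos.2 D.angle_lt)

theorem halfLength_eq : halfLength h ρ α = arcEnd ρ α + smoothenedLength h ρ α := rfl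

theorem halfPerimeter_eq :
    stadiumHalfPerimeter h ρ α L = 2 * (arcEnd ρ α + smoothenedLength h ρ α) + L := rfl

theorem halfPerimeter_pos (D : StadiumData h ρ α L) : 0 < stadiumHalfPerimeter h ρ α L := by
  have := D.arcEnd_pos
  have := D.smoothenedLength_pos
  have := D.separation_nonneg
  rw [halfPerimeter_eq]; positivity

theorem componentCurvature_eq (D : StadiumData h ρ α L) (t : ℝ) :
    componentCurvature h ρ α t
      = 1 / ρ * shapeExt h ((|t| - arcEnd ρ α) / smoothenedLength h ρ α) := by
  have hs := D.smoothenedLength_pos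
  unfold componentCurvature
  split_ifs with h1 h2
  · rw [D.shapeExt_of_nonpos, mul_one]
    exact div_nonpos_of_nonpos_of_nonneg (sub_nonpos.2 h1) hs.le
  · rw [shapeExt_of_mem]
    · rfl
    · constructor
      · exact div_nonneg (sub_nonneg.2 (not_le.1 h1).le) hs.le
      · rw [div_le_one hs]
        rw [halfLength_eq] at h2
        linarith
  · rw [D.shapeExt_of_one_le, mul_zero]
    rw [one_le_div hs]
    rw [halfLength_eq] at h2
    linarith

/-- The representative obtained with `round` has the norm of the class modulo the half perimeter as
its absolute value. Continuity, evenness and periodicity of the curvature are then inherited from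
the quotient norm. -/
theorem stadiumCurvature_eq (D : StadiumData h ρ α L) (s : ℝ) :
    stadiumCurvature h ρ α L s
      = 1 / ρ * shapeExt h ((‖(s : AddCircle (stadiumHalfPerimeter h ρ α L))‖ - arcEnd ρ α)
        / smoothenedLength h ρ α) := by
  rw [stadiumCurvature, D.componentCurvature_eq, AddCircle.norm_eq]
  congr 6
  rw [mul_comm, div_eq_inv_mul]

theorem curvature_continuous (D : StadiumData h ρ α L) : Continuous (stadiumCurvature h ρ α L) := by
  rw [funext D.stadiumCurvature_eq]
  refine continuous_const.mul (D.continuous_shapeExt.comp ?_)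
  exact ((continuous_norm.comp (AddCircle.continuous_mk' _)).sub continuous_const).div_const _

theorem curvature_nonneg (D : StadiumData h ρ α L) (s : ℝ) : 0 ≤ stadiumCurvature h ρ α L s := by
  rw [D.stadiumCurvature_eq]
  exact mul_nonneg (one_div_nonneg.2 D.radius_pos.le) (D.shapeExt_nonneg _)

theorem radius_mul_curvature_le (D : StadiumData h ρ α L) (s : ℝ) :
    ρ * stadiumCurvature h ρ α L s ≤ 1 := by
  rw [D.stadiumCurvature_eq, ← mul_assoc, mul_one_div_cancel D.radius_pos.ne', one_mul]
  exact D.shapeExt_le_one _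

theorem curvature_neg (D : StadiumData h ρ α L) (s : ℝ) :
    stadiumCurvature h ρ α L (-s) = stadiumCurvature h ρ α L s := by
  rw [D.stadiumCurvature_eq, D.stadiumCurvature_eq, AddCircle.coe_neg, norm_neg]

theorem curvature_add (D : StadiumData h ρ α L) (s : ℝ) :
    stadiumCurvature h ρ α L (s + stadiumHalfPerimeter h ρ α L) = stadiumCurvature h ρ α L s := by
  rw [D.stadiumCurvature_eq, D.stadiumCurvature_eq, AddCircle.coe_add_period]

theorem curvature_of_abs_le (D : StadiumData h ρ α L) {s : ℝ}
    (hs : |s| ≤ stadiumHalfPerimeter h ρ α L / 2) :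
    stadiumCurvature h ρ α L s
      = 1 / ρ * shapeExt h ((|s| - arcEnd ρ α) / smoothenedLength h ρ α) := by
  have := D.halfPerimeter_pos
  rw [D.stadiumCurvature_eq, (AddCircle.norm_coe_eq_abs_iff _ this.ne').2]
  rwa [abs_of_pos this]

theorem arcEnd_le (D : StadiumData h ρ α L) :
    arcEnd ρ α ≤ stadiumHalfPerimeter h ρ α L / 2 := by
  have := D.smoothenedLength_pos
  have := D.separation_nonneg
  rw [halfPerimeter_eq]; linarith

theorem curvature_arc (D : StadiumData h ρ α L) {s : ℝ} (hs : |s| ≤ arcEnd ρ α) :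
    stadiumCurvature h ρ α L s = 1 / ρ := by
  rw [D.curvature_of_abs_le (hs.trans D.arcEnd_le), D.shapeExt_of_nonpos, mul_one]
  exact div_nonpos_of_nonpos_of_nonneg (sub_nonpos.2 hs) D.smoothenedLength_pos.le

theorem smooth_bounds (D : StadiumData h ρ α L) {ζ : ℝ} (hζ : ζ ∈ Icc (0 : ℝ) 1) :
    arcEnd ρ α ≤ arcEnd ρ α + ζ * smoothenedLength h ρ α ∧
      arcEnd ρ α + ζ * smoothenedLength h ρ α ≤ stadiumHalfPerimeter h ρ α L / 2 := by
  have h1 := D.smoothenedLength_pos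
  have h2 := D.separation_nonneg
  rw [halfPerimeter_eq]
  constructor <;> nlinarith [hζ.1, hζ.2]

theorem curvature_smooth (D : StadiumData h ρ α L) {ζ : ℝ} (hζ : ζ ∈ Icc (0 : ℝ) 1) :
    stadiumCurvature h ρ α L (arcEnd ρ α + ζ * smoothenedLength h ρ α) = 1 / ρ * h ζ := by
  obtain ⟨h1, h2⟩ := D.smooth_bounds hζ
  have h0 := D.arcEnd_pos
  rw [D.curvature_of_abs_le (by rw [abs_of_nonneg (by linarith)]; exact h2),
    abs_of_nonneg (by linarith), add_sub_cancel_left,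
    mul_div_cancel_right₀ _ D.smoothenedLength_pos.ne', shapeExt_of_mem h hζ]

theorem hasDerivAt_angle (D : StadiumData h ρ α L) (s : ℝ) :
    HasDerivAt (stadiumTangentAngle h ρ α L) (stadiumCurvature h ρ α L s) s :=
  ((D.curvature_continuous.integral_hasStrictDerivAt 0 s).hasDerivAt).const_add _

theorem angle_continuous (D : StadiumData h ρ α L) : Continuous (stadiumTangentAngle h ρ α L) :=
  continuous_iff_continuousAt.2 fun s => (D.hasDerivAt_angle s).continuousAt

theorem angle_monotone (D : StadiumData h ρ α L) : Monotone (stadiumTangentAngle h ρ α L) :=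
  monotone_of_hasDerivAt_nonneg D.hasDerivAt_angle D.curvature_nonneg

theorem angle_zero : stadiumTangentAngle h ρ α L 0 = Real.pi / 2 := by
  simp [stadiumTangentAngle]

theorem angle_neg (D : StadiumData h ρ α L) (s : ℝ) :
    stadiumTangentAngle h ρ α L (-s) = Real.pi - stadiumTangentAngle h ρ α L s := by
  have : ∫ u in (0 : ℝ)..(-s), stadiumCurvature h ρ α L u
      = -∫ u in (0 : ℝ)..s, stadiumCurvature h ρ α L u := by
    have h1 := intervalIntegral.integral_comp_neg (a := 0) (b := s) (stadiumCurvature h ρ α L)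
    simp only [D.curvature_neg, neg_zero] at h1
    rw [intervalIntegral.integral_symm, ← h1]
  rw [stadiumTangentAngle, stadiumTangentAngle, this]; ring

theorem angle_arc (D : StadiumData h ρ α L) {s : ℝ} (hs : |s| ≤ arcEnd ρ α) :
    stadiumTangentAngle h ρ α L s = Real.pi / 2 + s / ρ := by
  have : ∫ u in (0 : ℝ)..s, stadiumCurvature h ρ α L u = ∫ _u in (0 : ℝ)..s, 1 / ρ := by
    refine intervalIntegral.integral_congr fun u hu => ?_
    refine D.curvature_arc (le_trans ?_ hs)
    simpa using abs_sub_left_of_mem_uIcc hu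
  rw [stadiumTangentAngle, this]
  simp [div_eq_mul_inv]

theorem angle_smooth (D : StadiumData h ρ α L) {ζ : ℝ} (hζ : ζ ∈ Icc (0 : ℝ) 1) :
    stadiumTangentAngle h ρ α L (arcEnd ρ α + ζ * smoothenedLength h ρ α)
      = Real.pi - α * (∫ ξ in ζ..1, h ξ) / ∫ ξ in (0 : ℝ)..1, h ξ := by
  have hi : ∀ x y : ℝ, IntervalIntegrable (stadiumCurvature h ρ α L) volume x y :=
    fun x y => D.curvature_continuous.intervalIntegrable x y
  have h0 := D.arcEnd_pos
  have hρ := D.radius_pos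
  have hI := D.integral_pos
  have e1 := D.angle_arc (s := arcEnd ρ α) (by rw [abs_of_pos h0])
  have e2 : ∫ u in arcEnd ρ α..(arcEnd ρ α + ζ * smoothenedLength h ρ α),
      stadiumCurvature h ρ α L u = smoothenedLength h ρ α * (1 / ρ * ∫ ξ in (0 : ℝ)..ζ, h ξ) := by
    have := intervalIntegral.mul_integral_comp_mul_add (a := 0) (b := ζ)
      (f := stadiumCurvature h ρ α L) (c := smoothenedLength h ρ α) (d := arcEnd ρ α)
    rw [mul_zero, zero_add, mul_comm _ ζ, add_comm (ζ * _)] at this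
    rw [← this, ← intervalIntegral.integral_const_mul (1 / ρ)]
    refine congrArg (smoothenedLength h ρ α * ·)
      (intervalIntegral.integral_congr fun u hu => ?_)
    rw [uIcc_of_le hζ.1] at hu
    have := D.curvature_smooth (L := L) (ζ := u) ⟨hu.1, hu.2.trans hζ.2⟩
    rw [mul_comm u, add_comm] at this
    exact this
  have e3 : (∫ ξ in (0 : ℝ)..ζ, h ξ) + ∫ ξ in ζ..1, h ξ = ∫ ξ in (0 : ℝ)..1, h ξ := by
    have hint : ∀ a ∈ Icc (0 : ℝ) 1, ∀ b ∈ Icc (0 : ℝ) 1, IntervalIntegrable h volume a b :=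
      fun a ha b hb => (D.cont.mono (uIcc_subset_Icc ha hb)).intervalIntegrable
    exact intervalIntegral.integral_add_adjacent_intervals
      (hint 0 (by simp) ζ hζ) (hint ζ hζ 1 (by simp))
  have e4 := intervalIntegral.integral_add_adjacent_intervals
    (hi 0 (arcEnd ρ α)) (hi (arcEnd ρ α) (arcEnd ρ α + ζ * smoothenedLength h ρ α))
  rw [stadiumTangentAngle] at e1 ⊢
  rw [← e4, ← add_assoc, e1, e2, eq_sub_of_add_eq e3, smoothenedLength]
  unfold arcEnd
  field_simp
  ring

theorem angle_half (D : StadiumData h ρ α L) :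
    stadiumTangentAngle h ρ α L (stadiumHalfPerimeter h ρ α L / 2) = Real.pi := by
  have hi : ∀ x y : ℝ, IntervalIntegrable (stadiumCurvature h ρ α L) volume x y :=
    fun x y => D.curvature_continuous.intervalIntegrable x y
  have e1 := D.angle_smooth (L := L) (ζ := 1) (by simp)
  have e2 : ∫ u in (arcEnd ρ α + 1 * smoothenedLength h ρ α)..(stadiumHalfPerimeter h ρ α L / 2),
      stadiumCurvature h ρ α L u = ∫ _u in
        (arcEnd ρ α + 1 * smoothenedLength h ρ α)..(stadiumHalfPerimeter h ρ α L / 2), (0 : ℝ) := by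
    refine intervalIntegral.integral_congr fun u hu => ?_
    rw [uIcc_of_le (D.smooth_bounds (by simp)).2] at hu
    have h0 := D.arcEnd_pos
    have h1 := D.smoothenedLength_pos
    have hu0 : 0 ≤ u := by linarith [hu.1]
    rw [D.curvature_of_abs_le (by rw [abs_of_nonneg hu0]; exact hu.2), D.shapeExt_of_one_le,
      mul_zero]
    rw [abs_of_nonneg hu0, one_le_div h1]
    linarith [hu.1]
  have e4 := intervalIntegral.integral_add_adjacent_intervals
    (hi 0 (arcEnd ρ α + 1 * smoothenedLength h ρ α))
    (hi (arcEnd ρ α + 1 * smoothenedLength h ρ α) (stadiumHalfPerimeter h ρ α L / 2))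
  rw [stadiumTangentAngle] at e1 ⊢
  rw [← e4, ← add_assoc, e1, e2]
  simp

theorem angle_add (D : StadiumData h ρ α L) (s : ℝ) :
    stadiumTangentAngle h ρ α L (s + stadiumHalfPerimeter h ρ α L)
      = stadiumTangentAngle h ρ α L s + Real.pi := by
  set H := stadiumHalfPerimeter h ρ α L with hH
  have hd : ∀ x, HasDerivAt (fun t => stadiumTangentAngle h ρ α L (t + H)
      - stadiumTangentAngle h ρ α L t) 0 x := fun x => by
    have h1 := ((D.hasDerivAt_angle (x + H)).comp_add_const x H).sub (D.hasDerivAt_angle x)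
    rwa [D.curvature_add, sub_self] at h1
  -- The constant difference is evaluated at `-(H / 2)`, where the angles are `0` and, half a
  -- perimeter later, `π`.
  have := is_const_of_deriv_eq_zero (fun x => (hd x).differentiableAt) (fun x => (hd x).deriv)
    s (-(H / 2))
  rw [show -(H / 2) + H = H / 2 by ring, D.angle_neg, D.angle_half] at this
  linarith

theorem hasDerivAt_curve (D : StadiumData h ρ α L) (s : ℝ) :
    HasDerivAt (boundaryCurve (stadiumTangentAngle h ρ α L))
      (unitVec (stadiumTangentAngle h ρ α L s)) s :=
  hasDerivAt_boundaryCurve D.angle_continuous s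

/-- Mirror symmetry in the horizontal axis, inherited from `angle_neg`; both sides have the same
derivative. -/
theorem curve_neg (D : StadiumData h ρ α L) (s : ℝ) :
    boundaryCurve (stadiumTangentAngle h ρ α L) (-s)
      = (starRingEnd ℂ) (boundaryCurve (stadiumTangentAngle h ρ α L) s) := by
  refine eq_of_hasDerivAt_eq (f' := fun s => unitVec (-stadiumTangentAngle h ρ α L s))
    (f := fun s => boundaryCurve (stadiumTangentAngle h ρ α L) (-s))
    (g := fun s => (starRingEnd ℂ) (boundaryCurve (stadiumTangentAngle h ρ α L) s))
    (fun x => ?_) (fun x => ?_) ?_ s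
  · have h1 := (D.hasDerivAt_curve (-x)).scomp x (hasDerivAt_neg x)
    refine h1.congr_deriv ?_
    rw [D.angle_neg, neg_smul, one_smul, ← unitVec_add_pi,
      show Real.pi - stadiumTangentAngle h ρ α L x + Real.pi
        = -stadiumTangentAngle h ρ α L x + Real.pi + Real.pi by ring,
      unitVec_add_pi, unitVec_add_pi, neg_neg]
  · have h1 := Complex.conjCLE.toContinuousLinearMap.hasFDerivAt.comp_hasDerivAt x
      (D.hasDerivAt_curve x)
    refine h1.congr_deriv ?_
    exact conj_unitVec _
  · simp [boundaryCurve]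

/-- Central symmetry of the table, which exchanges the two copies of `Γ`: the tangent turns by `π`
in half a perimeter. -/
theorem curve_add (D : StadiumData h ρ α L) (s : ℝ) :
    boundaryCurve (stadiumTangentAngle h ρ α L) (s + stadiumHalfPerimeter h ρ α L)
      = boundaryCurve (stadiumTangentAngle h ρ α L) (stadiumHalfPerimeter h ρ α L)
        - boundaryCurve (stadiumTangentAngle h ρ α L) s := by
  refine eq_of_hasDerivAt_eq (f' := fun s => -unitVec (stadiumTangentAngle h ρ α L s))
    (f := fun s => boundaryCurve (stadiumTangentAngle h ρ α L) (s + stadiumHalfPerimeter h ρ α L))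
    (g := fun s => boundaryCurve (stadiumTangentAngle h ρ α L) (stadiumHalfPerimeter h ρ α L)
        - boundaryCurve (stadiumTangentAngle h ρ α L) s)
    (fun x => ?_) (fun x => ?_) ?_ s
  · have h1 := (D.hasDerivAt_curve (x + stadiumHalfPerimeter h ρ α L)).comp_add_const x
      (stadiumHalfPerimeter h ρ α L)
    rwa [D.angle_add, unitVec_add_pi] at h1
  · exact (D.hasDerivAt_curve x).const_sub _
  · simp [boundaryCurve]

theorem convexTable (D : StadiumData h ρ α L) :
    ConvexTable (stadiumTangentAngle h ρ α L) (stadiumCurvature h ρ α L)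
      (2 * stadiumHalfPerimeter h ρ α L) where
  deriv := D.hasDerivAt_angle
  cont := D.curvature_continuous
  nonneg := D.curvature_nonneg
  turn s := by rw [two_mul, ← add_assoc, D.angle_add, D.angle_add]; ring
  closed s := by rw [two_mul, ← add_assoc, D.curve_add, D.curve_add]; ring

theorem curve_arc (D : StadiumData h ρ α L) {s : ℝ} (hs : |s| ≤ arcEnd ρ α) :
    boundaryCurve (stadiumTangentAngle h ρ α L) s = ρ * (unitVec (s / ρ) - 1) := by
  have hρ := D.radius_pos
  have e1 : ∫ u in (0 : ℝ)..s, unitVec (stadiumTangentAngle h ρ α L u)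
      = ∫ u in (0 : ℝ)..s, unitVec (Real.pi / 2 + u / ρ) := by
    refine intervalIntegral.integral_congr fun u hu => ?_
    rw [D.angle_arc (le_trans ?_ hs)]
    simpa using abs_sub_left_of_mem_uIcc hu
  have hd : ∀ x ∈ uIcc 0 s, HasDerivAt (fun t : ℝ => (ρ : ℂ) * unitVec (t / ρ))
      (unitVec (Real.pi / 2 + x / ρ)) x := fun x _ => by
    have h1 : HasDerivAt (fun t : ℝ => ((t / ρ : ℝ) : ℂ) * Complex.I) ((1 / ρ : ℝ) * Complex.I) x :=
      (((hasDerivAt_id x).div_const ρ).ofReal_comp).mul_const Complex.I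
    have h2 := (h1.cexp).const_mul (ρ : ℂ)
    refine h2.congr_deriv ?_
    have : unitVec (Real.pi / 2 + x / ρ) = unitVec (x / ρ) * Complex.I := by
      apply Complex.ext <;>
        simp [unitVec_re, unitVec_im, Real.cos_add, Real.sin_add]
    rw [this, unitVec]
    have : (ρ : ℂ) ≠ 0 := by exact_mod_cast hρ.ne'
    push_cast
    field_simp
  rw [boundaryCurve, e1, intervalIntegral.integral_eq_sub_of_hasDerivAt hd
    ((continuous_unitVec.comp (by fun_prop)).intervalIntegrable _ _)]
  simp [unitVec, mul_sub]

end StadiumData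

/-! ### Chords of the stadium -/

theorem unitVec_add_pi_div_two (x : ℝ) : unitVec (x + Real.pi / 2) = unitVec x * Complex.I := by
  apply Complex.ext <;> simp [unitVec_re, unitVec_im, Real.cos_add, Real.sin_add]

namespace StadiumData

variable {h : ℝ → ℝ} {ρ α L : ℝ}

theorem chord_shift (D : StadiumData h ρ α L) {τ : ℝ} {z w : ℝ × ℝ}
    (hc : IsChord (stadiumTangentAngle h ρ α L) (2 * stadiumHalfPerimeter h ρ α L) τ z w) :
    IsChord (stadiumTangentAngle h ρ α L) (2 * stadiumHalfPerimeter h ρ α L) τ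
      (z.1 + stadiumHalfPerimeter h ρ α L, z.2) (w.1 + stadiumHalfPerimeter h ρ α L, w.2) := by
  obtain ⟨h1, h2, h3, h4, h5, h6, h7⟩ := hc
  refine ⟨h1, h2, by simpa using h3, by dsimp only; linarith, h5, ?_, ?_⟩
  · dsimp only
    rw [D.curve_add, D.curve_add, h6]
    simp only [velocity, D.angle_add]
    rw [show stadiumTangentAngle h ρ α L z.1 + Real.pi + Real.pi / 2 - z.2
      = stadiumTangentAngle h ρ α L z.1 + Real.pi / 2 - z.2 + Real.pi by ring, unitVec_add_pi]
    ring
  · dsimp only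
    rw [D.angle_add, D.angle_add]; linarith

/-- Reflection in the horizontal axis is combined with time reversal. Each changes the sign of the
angle `φ` and the direction of travel along the boundary, so together they preserve both. -/
theorem chord_reverse (D : StadiumData h ρ α L) {τ : ℝ} {z w : ℝ × ℝ}
    (hc : IsChord (stadiumTangentAngle h ρ α L) (2 * stadiumHalfPerimeter h ρ α L) τ z w) :
    IsChord (stadiumTangentAngle h ρ α L) (2 * stadiumHalfPerimeter h ρ α L) τ
      (-w.1, w.2) (-z.1, z.2) := by
  obtain ⟨h1, h2, h3, h4, h5, h6, h7⟩ := hc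
  refine ⟨h2, h1, by simpa using h3, by dsimp only; linarith, h5, ?_, ?_⟩
  · dsimp only
    rw [D.curve_neg, D.curve_neg, h6]
    simp only [velocity, D.angle_neg, map_add, map_mul, Complex.conj_ofReal, conj_unitVec]
    rw [show Real.pi - stadiumTangentAngle h ρ α L w.1 + Real.pi / 2 - w.2
      = -(stadiumTangentAngle h ρ α L z.1 + Real.pi / 2 - z.2) + Real.pi by rw [h7]; ring,
      unitVec_add_pi]
    ring
  · dsimp only
    rw [D.angle_neg, D.angle_neg]; linarith

/-- A chord from the circular arc to another boundary point, whose supporting line is tangent to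
the caustic of radius `ρ cos (β / 2)`. -/
theorem chord_of_tangent (D : StadiumData h ρ α L) {β ω e s' φ' : ℝ} (hβ : 0 < β)
    (hβ' : β < Real.pi) (he : 0 < e + ρ * Real.sin (β / 2))
    (hs : |ρ * (ω - β / 2)| ≤ arcEnd ρ α) (hs' : ρ * (ω - β / 2) < s')
    (hs'' : s' < ρ * (ω - β / 2) + 2 * stadiumHalfPerimeter h ρ α L) (hφ : |φ'| < Real.pi / 2)
    (hφ' : φ' = Real.pi - stadiumTangentAngle h ρ α L s' + ω)
    (hcurve : boundaryCurve (stadiumTangentAngle h ρ α L) s' + ρ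
      = (ρ * Real.cos (β / 2) : ℝ) * unitVec ω + e * (unitVec ω * Complex.I)) :
    IsChord (stadiumTangentAngle h ρ α L) (2 * stadiumHalfPerimeter h ρ α L)
      (e + ρ * Real.sin (β / 2)) (ρ * (ω - β / 2), Real.pi / 2 - β / 2) (s', φ') := by
  have hρ := D.radius_pos
  have hang := D.angle_arc hs
  rw [mul_div_cancel_left₀ _ hρ.ne'] at hang
  refine ⟨by rw [abs_lt]; constructor <;> dsimp only <;> linarith [Real.pi_pos], hφ, hs', hs'', he,
    ?_, ?_⟩
  · dsimp only
    rw [eq_sub_of_add_eq hcurve, D.curve_arc hs, mul_div_cancel_left₀ _ hρ.ne']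
    simp only [velocity, hang]
    rw [show Real.pi / 2 + (ω - β / 2) + Real.pi / 2 - (Real.pi / 2 - β / 2)
      = ω + Real.pi / 2 by ring, unitVec_add_pi_div_two]
    -- On the supporting line, the arc point lies `ρ sin (β / 2)` behind the point of tangency.
    have : unitVec (ω - β / 2)
        = (Real.cos (β / 2) : ℂ) * unitVec ω - Real.sin (β / 2) * (unitVec ω * Complex.I) := by
      apply Complex.ext
      · simp [unitVec_re, unitVec_im, Real.cos_sub, -Complex.ofReal_cos, -Complex.ofReal_sin]; ring
      · simp [unitVec_re, unitVec_im, Real.sin_sub, -Complex.ofReal_cos, -Complex.ofReal_sin]; ring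
    rw [this]
    push_cast
    ring
  · dsimp only
    rw [hang, hφ']; ring

theorem arc_chord (D : StadiumData h ρ α L) {β t : ℝ} (hβ : 0 < β) (hβ' : β < Real.pi)
    (h1 : |ρ * t| ≤ arcEnd ρ α) (h2 : |ρ * (t + β)| ≤ arcEnd ρ α) :
    IsChord (stadiumTangentAngle h ρ α L) (2 * stadiumHalfPerimeter h ρ α L)
      (2 * (ρ * Real.sin (β / 2))) (ρ * t, Real.pi / 2 - β / 2)
      (ρ * (t + β), Real.pi / 2 - β / 2) := by
  have hρ := D.radius_pos
  have hsin : 0 < Real.sin (β / 2) := Real.sin_pos_of_pos_of_lt_pi (by linarith) (by linarith)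
  have hr := mul_pos hρ hsin
  have := D.chord_of_tangent (β := β) (ω := t + β / 2) (e := ρ * Real.sin (β / 2))
    (s' := ρ * (t + β)) (φ' := Real.pi / 2 - β / 2) hβ hβ' (by linarith)
    (by rwa [add_sub_cancel_right]) (by rw [add_sub_cancel_right]; nlinarith)
    (by
      rw [add_sub_cancel_right]
      have := D.arcEnd_le
      have := D.arcEnd_pos
      linarith [(abs_le.1 h1).1, (abs_le.1 h2).2])
    (by rw [abs_lt]; constructor <;> linarith [Real.pi_pos])
    (by rw [D.angle_arc h2, mul_div_cancel_left₀ _ hρ.ne']; ring)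
    (by
      rw [D.curve_arc h2, mul_div_cancel_left₀ _ hρ.ne', show t + β = t + β / 2 + β / 2 by ring]
      apply Complex.ext
      · simp [unitVec_re, unitVec_im, Real.cos_add, -Complex.ofReal_cos, -Complex.ofReal_sin]; ring
      · simp [unitVec_re, unitVec_im, Real.sin_add, -Complex.ofReal_cos, -Complex.ofReal_sin]; ring)
  rwa [add_sub_cancel_right, ← two_mul] at this

/-- The orbit segment on the circular arc. -/
theorem arc_segment (D : StadiumData h ρ α L) {β : ℝ} (n : ℕ) (hβ : 0 < β) (hβ' : β < Real.pi)
    (hn : ρ * (n * β) ≤ arcEnd ρ α) (c : ℝ)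
    (hc : ∀ z w τ, IsChord (stadiumTangentAngle h ρ α L) (2 * stadiumHalfPerimeter h ρ α L) τ z w →
      IsChord (stadiumTangentAngle h ρ α L) (2 * stadiumHalfPerimeter h ρ α L) τ
        (z.1 + c, z.2) (w.1 + c, w.2))
    (hκ : ∀ s, stadiumCurvature h ρ α L (s + c) = stadiumCurvature h ρ α L s) :
    OrbitSegment (stadiumTangentAngle h ρ α L) (stadiumCurvature h ρ α L)
      (2 * stadiumHalfPerimeter h ρ α L)
      (-(ρ * (n * β)) + c, Real.pi / 2 - β / 2) (ρ * (n * β) + c, Real.pi / 2 - β / 2) (2 * n)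
      (flight (2 * (ρ * Real.sin (β / 2))) (2 / (ρ * Real.sin (β / 2))) ^ (2 * n)) := by
  have hρ := D.radius_pos
  have habs : ∀ j : ℕ, j ≤ 2 * n → |ρ * (((j : ℝ) - n) * β)| ≤ arcEnd ρ α := fun j hj => by
    have hj' : (j : ℝ) ≤ 2 * n := by exact_mod_cast hj
    refine le_trans ?_ hn
    have hρβ := mul_pos hρ hβ
    have : |(j : ℝ) - n| ≤ n := by
      rw [abs_le]; constructor <;> linarith [(Nat.cast_nonneg j : (0 : ℝ) ≤ j)]
    rw [abs_mul, abs_mul, abs_of_pos hρ, abs_of_pos hβ]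
    gcongr
  -- The `2 n + 1` collisions sit at the angles `(j - n) β`, symmetric about the middle of the arc;
  -- the shift `c` selects the copy of `Γ`.
  have key := OrbitSegment.ofChords D.convexTable (τ := 2 * (ρ * Real.sin (β / 2)))
    (g := 2 / (ρ * Real.sin (β / 2)))
    (fun j : ℕ => (ρ * (((j : ℝ) - n) * β) + c, Real.pi / 2 - β / 2)) (2 * n)
    (fun j hj => by
      have h1 := D.arc_chord hβ hβ' (habs j (by omega)) (by
        have := habs (j + 1) (by omega)
        rwa [show (((j + 1 : ℕ) : ℝ) - n) * β = ((j : ℝ) - n) * β + β by push_cast; ring] at this)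
      have h2 := hc _ _ _ h1
      simp only at h2 ⊢
      rwa [show (((j + 1 : ℕ) : ℝ) - n) * β = ((j : ℝ) - n) * β + β by push_cast; ring])
    (fun j hj => by
      simp only
      rw [hκ, D.curvature_arc (habs (j + 1) (by omega)), Real.cos_pi_div_two_sub]
      field_simp)
  convert key using 2
  · push_cast; ring
  · push_cast; ring

/-- A periodic orbit with `4 n + 4` collisions that is symmetric about the horizontal axis. -/
theorem hasEllipticPeriodicOrbit (D : StadiumData h ρ α L) (n : ℕ) {σ φ β β' e e' : ℝ}
    (hβ : 0 < β) (hβπ : β < Real.pi) (hβ' : 0 < β') (hβπ' : β' < Real.pi)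
    (hn : ρ * (n * β) < arcEnd ρ α) (hn' : ρ * (n * β') < arcEnd ρ α)
    (hσ : arcEnd ρ α ≤ σ) (hσ' : σ ≤ stadiumHalfPerimeter h ρ α L / 2)
    (hφ : |φ| < Real.pi / 2) (he : 0 < e) (he' : 0 < e')
    (h1 : φ = Real.pi - stadiumTangentAngle h ρ α L σ + (n + 1 / 2) * β)
    (h2 : φ = -(Real.pi - stadiumTangentAngle h ρ α L σ) + (n + 1 / 2) * β')
    (hc : boundaryCurve (stadiumTangentAngle h ρ α L) σ + ρ
      = (ρ * Real.cos (β / 2) : ℝ) * unitVec ((n + 1 / 2) * β)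
        + e * (unitVec ((n + 1 / 2) * β) * Complex.I))
    (hc' : boundaryCurve (stadiumTangentAngle h ρ α L) (stadiumHalfPerimeter h ρ α L - σ) + ρ
      = (ρ * Real.cos (β' / 2) : ℝ) * unitVec ((n + 1 / 2) * β')
        + e' * (unitVec ((n + 1 / 2) * β') * Complex.I))
    (ht : (arcUpper n (ρ * Real.sin (β / 2)) e - arcUpper n (ρ * Real.sin (β' / 2)) e') ^ 2
      < returnTrace n (ρ * Real.sin (β / 2)) e (ρ * Real.sin (β' / 2)) e'
        (2 * stadiumCurvature h ρ α L σ / Real.cos φ) ^ 2)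
    (ht' : returnTrace n (ρ * Real.sin (β / 2)) e (ρ * Real.sin (β' / 2)) e'
        (2 * stadiumCurvature h ρ α L σ / Real.cos φ) ^ 2
      < (arcUpper n (ρ * Real.sin (β / 2)) e + arcUpper n (ρ * Real.sin (β' / 2)) e') ^ 2) :
    HasEllipticPeriodicOrbit (stadiumTangentAngle h ρ α L)
      (2 * stadiumHalfPerimeter h ρ α L) := by
  have hρ := D.radius_pos
  have hH := D.halfPerimeter_pos
  have ha := D.arcEnd_pos
  have hle := D.arcEnd_le
  set H := stadiumHalfPerimeter h ρ α L with hHdef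
  have hr : 0 < ρ * Real.sin (β / 2) :=
    mul_pos hρ (Real.sin_pos_of_pos_of_lt_pi (by linarith) (by linarith))
  have hr' : 0 < ρ * Real.sin (β' / 2) :=
    mul_pos hρ (Real.sin_pos_of_pos_of_lt_pi (by linarith) (by linarith))
  have hnβ : 0 ≤ ρ * (n * β) := by positivity
  have hnβ' : 0 ≤ ρ * (n * β') := by positivity
  have o (b : ℝ) : ((n : ℝ) + 1 / 2) * b - b / 2 = n * b := by ring
  have C1 := D.chord_of_tangent (β := β) (ω := (n + 1 / 2) * β) (e := e) (s' := σ) (φ' := φ)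
    hβ hβπ (by linarith) (by rw [o, abs_of_nonneg hnβ]; exact hn.le) (by rw [o]; linarith)
    (by rw [o]; linarith) hφ h1 hc
  have C2 := D.chord_of_tangent (β := β') (ω := (n + 1 / 2) * β') (e := e') (s' := H - σ) (φ' := φ)
    hβ' hβπ' (by linarith) (by rw [o, abs_of_nonneg hnβ']; exact hn'.le)
    (by rw [o]; linarith) (by rw [o]; linarith) hφ
    (by rw [show H - σ = -σ + H by ring, D.angle_add, D.angle_neg, h2]; ring) hc'
  rw [o] at C1 C2
  -- `C2` ends at `H - σ`, the mirror image of the exceptional point in the vertical axis. Symmetry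
  -- makes of it the chords `C3` from `σ` to the left arc and `C4` from there to the bottom point
  -- `-σ + 2 H`; `C5` returns to the right arc.
  have C3 := D.chord_shift (D.chord_reverse C2)
  have C4 := D.chord_shift C2
  have C5 := D.chord_shift (D.chord_shift (D.chord_reverse C1))
  simp only [← hHdef] at C3 C4 C5
  rw [show -(H - σ) + H = σ by ring] at C3
  rw [show H - σ + H = -σ + H + H by ring] at C4
  have T := D.convexTable
  rw [← hHdef] at T
  have g (b : ℝ) (hb : 0 < ρ * Real.sin (b / 2)) :
      2 * (1 / ρ) / Real.cos (Real.pi / 2 - b / 2) = 2 / (ρ * Real.sin (b / 2)) := by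
    rw [Real.cos_pi_div_two_sub]; field_simp
  have S1 := D.arc_segment n hβ hβπ hn.le 0 (fun z w τ hzw => by simpa using hzw) (by simp)
  have S2 := OrbitSegment.ofChord T C1
  have S3 := OrbitSegment.ofChord T C3
  have S4 := D.arc_segment n hβ' hβπ' hn'.le H (fun z w τ hzw => D.chord_shift hzw)
    D.curvature_add
  have S5 := OrbitSegment.ofChord T C4
  have S6 := OrbitSegment.ofChord T C5
  simp only [add_zero] at S1
  simp only [hHdef, D.curvature_add, D.curvature_neg] at S3 S4 S5 S6
  rw [D.curvature_arc (by rw [abs_of_nonneg hnβ']; exact hn'.le), g β' hr'] at S3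
  rw [D.curvature_arc (by rw [abs_of_nonneg hnβ]; exact hn.le), g β hr] at S6
  simp only [← hHdef] at S1 S3 S4 S5 S6
  have S := ((((S1.trans S2).trans S3).trans S4).trans S5).trans S6
  refine OrbitSegment.hasEllipticPeriodicOrbit (z := (-(ρ * (n * β)), Real.pi / 2 - β / 2))
    (κ := stadiumCurvature h ρ α L) (by convert S using 2; ring) (by omega) ?_ ?_
    (abs_trace_lt_two hr hr' he he' ht ht')
  · rw [two_mul, ← add_assoc, D.curvature_add, D.curvature_add]
  · simp [Matrix.det_mul, Matrix.det_pow, det_flight]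

end StadiumData

/-! ### Estimates for the boundary curve -/

theorem slope_bounds {f f' : ℝ → ℝ} (hf : ∀ x, HasDerivAt f (f' x) x) {a b m M : ℝ} (hab : a ≤ b)
    (hm : ∀ x ∈ Icc a b, m ≤ f' x ∧ f' x ≤ M) :
    m * (b - a) ≤ f b - f a ∧ f b - f a ≤ M * (b - a) := by
  rcases hab.eq_or_lt with rfl | hlt
  · simp
  obtain ⟨c, hc, hs⟩ := exists_hasDerivAt_eq_slope f f' hlt
    (continuous_iff_continuousAt.2 fun x => (hf x).continuousAt).continuousOn fun x _ => hf x
  have hpos : 0 < b - a := sub_pos.2 hlt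
  rw [eq_div_iff hpos.ne'] at hs
  obtain ⟨h1, h2⟩ := hm c (Ioo_subset_Icc_self hc)
  rw [← hs]
  exact ⟨mul_le_mul_of_nonneg_right h1 hpos.le, mul_le_mul_of_nonneg_right h2 hpos.le⟩

/-- Boundary point on the smoothened segment, at the fraction `ζ` of its length. -/
noncomputable def smoothPoint (h : ℝ → ℝ) (ρ α ζ : ℝ) : ℝ :=
  arcEnd ρ α + ζ * smoothenedLength h ρ α

/-- Distance between the centres of the two circular arcs. -/
noncomputable def centreDistance (h : ℝ → ℝ) (ρ α L : ℝ) : ℝ :=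
  -2 * ρ - (boundaryCurve (stadiumTangentAngle h ρ α L) (stadiumHalfPerimeter h ρ α L)).re

/-- Distance of a point of the smoothened segment from the vertical axis of symmetry. -/
noncomputable def axisDistance (h : ℝ → ℝ) (ρ α L ζ : ℝ) : ℝ :=
  (boundaryCurve (stadiumTangentAngle h ρ α L) (smoothPoint h ρ α ζ)).re
    - (boundaryCurve (stadiumTangentAngle h ρ α L) (stadiumHalfPerimeter h ρ α L)).re / 2

/-- Height of a point of the smoothened segment above the horizontal axis of symmetry. -/
noncomputable def axisHeight (h : ℝ → ℝ) (ρ α L ζ : ℝ) : ℝ :=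
  (boundaryCurve (stadiumTangentAngle h ρ α L) (smoothPoint h ρ α ζ)).im

/-- The angle by which the tangent turns between a point of the smoothened segment and the end of
the segment. -/
noncomputable def restAngle (h : ℝ → ℝ) (ρ α L ζ : ℝ) : ℝ :=
  Real.pi - stadiumTangentAngle h ρ α L (smoothPoint h ρ α ζ)

namespace StadiumData

variable {h : ℝ → ℝ} {ρ α L : ℝ}

theorem hasDerivAt_re (D : StadiumData h ρ α L) (s : ℝ) :
    HasDerivAt (fun t => (boundaryCurve (stadiumTangentAngle h ρ α L) t).re)
      (Real.cos (stadiumTangentAngle h ρ α L s)) s :=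
  (hasStrictDerivAt_boundaryCurve_re D.angle_continuous s).hasDerivAt

theorem hasDerivAt_im (D : StadiumData h ρ α L) (s : ℝ) :
    HasDerivAt (fun t => (boundaryCurve (stadiumTangentAngle h ρ α L) t).im)
      (Real.sin (stadiumTangentAngle h ρ α L s)) s :=
  (hasStrictDerivAt_boundaryCurve_im D.angle_continuous s).hasDerivAt

theorem curve_half (D : StadiumData h ρ α L) :
    (boundaryCurve (stadiumTangentAngle h ρ α L) (stadiumHalfPerimeter h ρ α L / 2)).re
      = (boundaryCurve (stadiumTangentAngle h ρ α L) (stadiumHalfPerimeter h ρ α L)).re / 2 := by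
  have h1 := D.curve_add (-(stadiumHalfPerimeter h ρ α L / 2))
  rw [show -(stadiumHalfPerimeter h ρ α L / 2) + stadiumHalfPerimeter h ρ α L
    = stadiumHalfPerimeter h ρ α L / 2 by ring, D.curve_neg] at h1
  have := congrArg Complex.re h1
  simp at this
  linarith

theorem curve_period_im (D : StadiumData h ρ α L) :
    (boundaryCurve (stadiumTangentAngle h ρ α L) (stadiumHalfPerimeter h ρ α L)).im = 0 := by
  have h1 := D.curve_add (-(stadiumHalfPerimeter h ρ α L))
  rw [neg_add_cancel, D.curve_neg] at h1
  have := congrArg Complex.im h1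
  simp [boundaryCurve] at this
  simp [boundaryCurve]
  linarith

theorem smoothPoint_bounds (D : StadiumData h ρ α L) {ζ : ℝ} (hζ : ζ ∈ Icc (0 : ℝ) 1) :
    arcEnd ρ α ≤ smoothPoint h ρ α ζ ∧
      smoothPoint h ρ α ζ ≤ stadiumHalfPerimeter h ρ α L / 2 :=
  D.smooth_bounds hζ

theorem angle_arcEnd (D : StadiumData h ρ α L) :
    stadiumTangentAngle h ρ α L (arcEnd ρ α) = Real.pi - α := by
  rw [D.angle_arc (abs_of_pos D.arcEnd_pos).le, arcEnd, mul_div_cancel_left₀ _ D.radius_pos.ne']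
  ring

theorem axisDistance_bounds (D : StadiumData h ρ α L) {ζ : ℝ} (hζ : ζ ∈ Icc (0 : ℝ) 1) :
    Real.cos α * ((1 - ζ) * smoothenedLength h ρ α + L / 2) ≤ axisDistance h ρ α L ζ ∧
      axisDistance h ρ α L ζ ≤ (1 - ζ) * smoothenedLength h ρ α + L / 2 := by
  obtain ⟨h1, h2⟩ := D.smoothPoint_bounds (L := L) hζ
  have hb := slope_bounds D.hasDerivAt_re (m := -1) (M := -Real.cos α) h2 fun x hx => by
    have l1 := D.angle_monotone (h1.trans hx.1)
    have l2 := D.angle_monotone hx.2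
    rw [D.angle_arcEnd] at l1
    rw [D.angle_half] at l2
    refine ⟨Real.neg_one_le_cos _, ?_⟩
    rw [← Real.cos_pi_sub]
    exact Real.cos_le_cos_of_nonneg_of_le_pi (by linarith [D.angle_lt, Real.pi_pos]) l2 l1
  have hd : stadiumHalfPerimeter h ρ α L / 2 - smoothPoint h ρ α ζ
      = (1 - ζ) * smoothenedLength h ρ α + L / 2 := by
    rw [halfPerimeter_eq, smoothPoint]; ring
  rw [D.curve_half, hd] at hb
  unfold axisDistance
  constructor <;> linarith [hb.1, hb.2]

theorem curve_arcEnd (D : StadiumData h ρ α L) :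
    boundaryCurve (stadiumTangentAngle h ρ α L) (arcEnd ρ α)
      = ρ * (unitVec (Real.pi / 2 - α) - 1) := by
  rw [D.curve_arc (abs_of_pos D.arcEnd_pos).le, arcEnd, mul_div_cancel_left₀ _ D.radius_pos.ne']

theorem axisHeight_bounds (D : StadiumData h ρ α L) {ζ : ℝ} (hζ : ζ ∈ Icc (0 : ℝ) 1) :
    ρ * Real.cos α ≤ axisHeight h ρ α L ζ ∧
      axisHeight h ρ α L ζ ≤ ρ * Real.cos α + smoothenedLength h ρ α := by
  obtain ⟨h1, h2⟩ := D.smoothPoint_bounds (L := L) hζ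
  have hb := slope_bounds D.hasDerivAt_im (m := 0) (M := 1) h1 fun x hx => by
    have l1 := D.angle_monotone hx.1
    have l2 := D.angle_monotone (hx.2.trans h2)
    rw [D.angle_arcEnd] at l1
    rw [D.angle_half] at l2
    exact ⟨Real.sin_nonneg_of_nonneg_of_le_pi (by linarith [D.angle_lt, Real.pi_pos]) l2,
      Real.sin_le_one _⟩
  have e1 : (boundaryCurve (stadiumTangentAngle h ρ α L) (arcEnd ρ α)).im = ρ * Real.cos α := by
    rw [D.curve_arcEnd]
    simp [unitVec_im, Real.sin_pi_div_two_sub]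
  rw [e1, zero_mul, one_mul] at hb
  have hd : smoothPoint h ρ α ζ - arcEnd ρ α = ζ * smoothenedLength h ρ α := by
    rw [smoothPoint]; ring
  have := D.smoothenedLength_pos
  unfold axisHeight
  constructor
  · linarith [hb.1]
  · nlinarith [hb.2, hζ.2]

theorem centreDistance_bounds (D : StadiumData h ρ α L) :
    0 ≤ centreDistance h ρ α L ∧ centreDistance h ρ α L ≤ 2 * smoothenedLength h ρ α + L := by
  have hH := D.halfPerimeter_pos
  have hρ := D.radius_pos
  constructor
  -- The function `Re γ - ρ sin θ` is constant on a circle of radius `ρ`. Here its derivative is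
  -- `cos θ (1 - ρ κ) ≤ 0`, as the curvature is at most `1 / ρ`. Only this upper bound matters; `-2`
  -- is a crude lower one.
  · have hb := slope_bounds (f := fun s => (boundaryCurve (stadiumTangentAngle h ρ α L) s).re
        - ρ * Real.sin (stadiumTangentAngle h ρ α L s))
      (fun x => (D.hasDerivAt_re x).sub (((D.hasDerivAt_angle x).sin).const_mul ρ))
      (a := 0) (b := stadiumHalfPerimeter h ρ α L / 2) (m := -2) (M := 0) (by linarith)
      fun x hx => by
        have l1 := D.angle_monotone hx.1
        have l2 := D.angle_monotone hx.2
        rw [angle_zero] at l1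
        rw [D.angle_half] at l2
        have hc : Real.cos (stadiumTangentAngle h ρ α L x) ≤ 0 :=
          Real.cos_nonpos_of_pi_div_two_le_of_le l1 (by linarith [Real.pi_pos])
        have hc' := Real.neg_one_le_cos (stadiumTangentAngle h ρ α L x)
        have k1 := D.radius_mul_curvature_le x
        have k0 := mul_nonneg hρ.le (D.curvature_nonneg x)
        constructor <;> nlinarith
    have := hb.2
    rw [D.curve_half, D.angle_half, angle_zero] at this
    simp [boundaryCurve] at this
    unfold centreDistance
    simp only [boundaryCurve]
    linarith
  · have h1 := (D.axisDistance_bounds (ζ := 0) (by simp)).2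
    have e1 : (boundaryCurve (stadiumTangentAngle h ρ α L) (arcEnd ρ α)).re
        = ρ * (Real.sin α - 1) := by
      rw [D.curve_arcEnd]
      simp [unitVec_re, Real.cos_pi_div_two_sub]
    rw [axisDistance, smoothPoint, zero_mul, add_zero, e1] at h1
    have hsin : 0 ≤ ρ * Real.sin α := mul_nonneg hρ.le
      (Real.sin_nonneg_of_nonneg_of_le_pi D.angle_pos.le (by linarith [D.angle_lt, Real.pi_pos]))
    unfold centreDistance
    linarith

theorem restAngle_eq (D : StadiumData h ρ α L) {ζ : ℝ} (hζ : ζ ∈ Icc (0 : ℝ) 1) :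
    restAngle h ρ α L ζ = α * ((∫ ξ in ζ..1, h ξ) / ∫ ξ in (0 : ℝ)..1, h ξ) := by
  rw [restAngle, smoothPoint, D.angle_smooth hζ]; ring

theorem restAngle_bounds (D : StadiumData h ρ α L) {ζ : ℝ} (hζ : ζ ∈ Icc (0 : ℝ) 1) :
    0 ≤ restAngle h ρ α L ζ ∧ restAngle h ρ α L ζ ≤ α := by
  obtain ⟨h1, h2⟩ := D.smoothPoint_bounds (L := L) hζ
  have l1 := D.angle_monotone h1
  have l2 := D.angle_monotone h2
  rw [D.angle_arcEnd] at l1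
  rw [D.angle_half] at l2
  unfold restAngle
  constructor <;> linarith

theorem continuous_smoothPoint : Continuous (smoothPoint h ρ α) := by
  unfold smoothPoint; fun_prop

theorem continuous_axisDistance (D : StadiumData h ρ α L) :
    Continuous (axisDistance h ρ α L) :=
  ((continuous_iff_continuousAt.2 fun s => (D.hasDerivAt_re s).continuousAt).comp
    continuous_smoothPoint).sub continuous_const

theorem continuous_axisHeight (D : StadiumData h ρ α L) : Continuous (axisHeight h ρ α L) :=
  (continuous_iff_continuousAt.2 fun s => (D.hasDerivAt_im s).continuousAt).comp
    continuous_smoothPoint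

theorem continuous_restAngle (D : StadiumData h ρ α L) : Continuous (restAngle h ρ α L) :=
  continuous_const.sub (D.angle_continuous.comp continuous_smoothPoint)

end StadiumData

/-! ### The orbit equations in dimensionless parameters -/

/-- Coordinate along the direction `ω + π / 2` of the point `(x, b)`. -/
noncomputable def tangentDist (x b ω : ℝ) : ℝ := b * Real.cos ω - x * Real.sin ω

theorem arcUpper_scale (n : ℕ) {ρ : ℝ} (hρ : ρ ≠ 0) (r e : ℝ) :
    arcUpper n (ρ * r) (ρ * e) = ρ * arcUpper n r e := by
  unfold arcUpper
  rw [show ρ * e * ((2 * n + 1) * 2 / (ρ * r)) = e * ((2 * n + 1) * 2 / r) * (ρ / ρ) by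
    simp only [div_eq_mul_inv, mul_inv]; ring, div_self hρ]
  ring

theorem arcDiag_scale (n : ℕ) {ρ : ℝ} (hρ : ρ ≠ 0) (r e : ℝ) :
    arcDiag n (ρ * r) (ρ * e) = arcDiag n r e := by
  unfold arcDiag
  rw [show ρ * e * ((2 * n + 1) * 2 / (ρ * r)) = e * ((2 * n + 1) * 2 / r) * (ρ / ρ) by
    simp only [div_eq_mul_inv, mul_inv]; ring, div_self hρ]
  ring

theorem returnTrace_scale (n : ℕ) {ρ : ℝ} (hρ : ρ ≠ 0) (r e r' e' k : ℝ) :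
    returnTrace n (ρ * r) (ρ * e) (ρ * r') (ρ * e') (1 / ρ * k) = ρ * returnTrace n r e r' e' k := by
  unfold returnTrace
  rw [arcDiag_scale n hρ, arcDiag_scale n hρ, arcUpper_scale n hρ, arcUpper_scale n hρ]
  field_simp

/-- The conditions on the dimensionless parameters of a symmetric periodic orbit that are open:
the position `(x, b)` of the exceptional collision, the distance `w` of the centres, the rest angle
`η`, the incidence angle `(n + 1/2) μ`, the relative curvature `k` and the angle `α`. -/
structure OrbitCondition (n : ℕ) (x w b η μ k α : ℝ) : Prop where
  lower_pos : 0 < μ - η / (n + 1 / 2)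
  lower_lt : μ - η / (n + 1 / 2) < Real.pi
  upper_pos : 0 < μ + η / (n + 1 / 2)
  upper_lt : μ + η / (n + 1 / 2) < Real.pi
  lower_arc : n * (μ - η / (n + 1 / 2)) < Real.pi / 2 - α
  upper_arc : n * (μ + η / (n + 1 / 2)) < Real.pi / 2 - α
  incidence : |(n + 1 / 2) * μ| < Real.pi / 2
  dist_pos : 0 < tangentDist (x - w / 2) b ((n + 1 / 2) * μ - η)
  dist_pos' : 0 < tangentDist (-x - w / 2) b ((n + 1 / 2) * μ + η)
  trace_lower :
    (arcUpper n (Real.sin ((μ - η / (n + 1 / 2)) / 2)) (tangentDist (x - w / 2) b ((n + 1 / 2) * μ - η))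
      - arcUpper n (Real.sin ((μ + η / (n + 1 / 2)) / 2))
        (tangentDist (-x - w / 2) b ((n + 1 / 2) * μ + η))) ^ 2
      < returnTrace n (Real.sin ((μ - η / (n + 1 / 2)) / 2))
        (tangentDist (x - w / 2) b ((n + 1 / 2) * μ - η)) (Real.sin ((μ + η / (n + 1 / 2)) / 2))
        (tangentDist (-x - w / 2) b ((n + 1 / 2) * μ + η)) (2 * k / Real.cos ((n + 1 / 2) * μ)) ^ 2
  trace_upper :
    returnTrace n (Real.sin ((μ - η / (n + 1 / 2)) / 2))
        (tangentDist (x - w / 2) b ((n + 1 / 2) * μ - η)) (Real.sin ((μ + η / (n + 1 / 2)) / 2))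
        (tangentDist (-x - w / 2) b ((n + 1 / 2) * μ + η)) (2 * k / Real.cos ((n + 1 / 2) * μ)) ^ 2
      < (arcUpper n (Real.sin ((μ - η / (n + 1 / 2)) / 2))
          (tangentDist (x - w / 2) b ((n + 1 / 2) * μ - η))
        + arcUpper n (Real.sin ((μ + η / (n + 1 / 2)) / 2))
          (tangentDist (-x - w / 2) b ((n + 1 / 2) * μ + η))) ^ 2

/-- Sum of the two tangency conditions. -/
noncomputable def tangencySum (n : ℕ) (x w b η μ : ℝ) : ℝ :=
  2 * x * Real.sin ((n + 1 / 2) * μ) * Real.sin η - w * Real.cos ((n + 1 / 2) * μ) * Real.cos η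
    + 2 * b * Real.sin ((n + 1 / 2) * μ) * Real.cos η
    - 2 * Real.cos (μ / 2) * Real.cos (η / (n + 1 / 2) / 2)

/-- Difference of the two tangency conditions. -/
noncomputable def tangencyDiff (n : ℕ) (x w b η μ : ℝ) : ℝ :=
  2 * x * Real.cos ((n + 1 / 2) * μ) * Real.cos η - w * Real.sin ((n + 1 / 2) * μ) * Real.sin η
    - 2 * b * Real.cos ((n + 1 / 2) * μ) * Real.sin η
    - 2 * Real.sin (μ / 2) * Real.sin (η / (n + 1 / 2) / 2)

/-- Each tangency condition fixes the distance of a supporting line from the centre of its arc. Sum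
and difference separate the scales: the sum determines `μ` already in the limit, while the
difference degenerates at order `α` and determines `ζ`. -/
theorem tangency_of_sum_of_diff {n : ℕ} {x w b η μ : ℝ} (hs : tangencySum n x w b η μ = 0)
    (hd : tangencyDiff n x w b η μ = 0) :
    (x - w / 2) * Real.cos ((n + 1 / 2) * μ - η) + b * Real.sin ((n + 1 / 2) * μ - η)
        = Real.cos ((μ - η / (n + 1 / 2)) / 2) ∧
      (-x - w / 2) * Real.cos ((n + 1 / 2) * μ + η) + b * Real.sin ((n + 1 / 2) * μ + η)
        = Real.cos ((μ + η / (n + 1 / 2)) / 2) := by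
  unfold tangencySum at hs
  unfold tangencyDiff at hd
  rw [sub_div, add_div]
  simp only [Real.cos_add, Real.cos_sub, Real.sin_add, Real.sin_sub]
  constructor
  · linear_combination (hs + hd) / 2
  · linear_combination (hs - hd) / 2

namespace StadiumData

variable {h : ℝ → ℝ} {ρ α L : ℝ}

/-- With `β = μ - η / (n + 1/2)`, `β' = μ + η / (n + 1/2)` and incidence angle `(n + 1/2) μ`, both
reflection laws at the exceptional point hold identically. Only tangency is left to impose, and the
radius scales out. -/
theorem elliptic_of_tangency (D : StadiumData h ρ α L) (n : ℕ) {ζ μ : ℝ} (hζ : ζ ∈ Icc (0 : ℝ) 1)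
    (hs : tangencySum n (axisDistance h ρ α L ζ / ρ) (centreDistance h ρ α L / ρ)
      (axisHeight h ρ α L ζ / ρ) (restAngle h ρ α L ζ) μ = 0)
    (hd : tangencyDiff n (axisDistance h ρ α L ζ / ρ) (centreDistance h ρ α L / ρ)
      (axisHeight h ρ α L ζ / ρ) (restAngle h ρ α L ζ) μ = 0)
    (hO : OrbitCondition n (axisDistance h ρ α L ζ / ρ) (centreDistance h ρ α L / ρ)
      (axisHeight h ρ α L ζ / ρ) (restAngle h ρ α L ζ) μ (h ζ) α) :
    HasEllipticPeriodicOrbit (stadiumTangentAngle h ρ α L)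
      (2 * stadiumHalfPerimeter h ρ α L) := by
  have hρ := D.radius_pos
  obtain ⟨b1, b2⟩ := D.smoothPoint_bounds (L := L) hζ
  obtain ⟨t1, t2⟩ := tangency_of_sum_of_diff hs hd
  have hm : (n : ℝ) + 1 / 2 ≠ 0 := by positivity
  have m1 : ((n : ℝ) + 1 / 2) * (μ - restAngle h ρ α L ζ / (n + 1 / 2))
      = (n + 1 / 2) * μ - restAngle h ρ α L ζ := by field_simp
  have m2 : ((n : ℝ) + 1 / 2) * (μ + restAngle h ρ α L ζ / (n + 1 / 2))
      = (n + 1 / 2) * μ + restAngle h ρ α L ζ := by field_simp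
  have hκ : stadiumCurvature h ρ α L (smoothPoint h ρ α ζ) = 1 / ρ * h ζ := D.curvature_smooth hζ
  have hX : (boundaryCurve (stadiumTangentAngle h ρ α L) (smoothPoint h ρ α ζ)).re + ρ
      = ρ * (axisDistance h ρ α L ζ / ρ - centreDistance h ρ α L / ρ / 2) := by
    rw [axisDistance, centreDistance]; field_simp; ring
  have hX' : (boundaryCurve (stadiumTangentAngle h ρ α L)
        (stadiumHalfPerimeter h ρ α L)).re
      - (boundaryCurve (stadiumTangentAngle h ρ α L) (smoothPoint h ρ α ζ)).re + ρ
      = ρ * (-(axisDistance h ρ α L ζ / ρ) - centreDistance h ρ α L / ρ / 2) := by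
    rw [axisDistance, centreDistance]; field_simp; ring
  have hY : (boundaryCurve (stadiumTangentAngle h ρ α L) (smoothPoint h ρ α ζ)).im
      = ρ * (axisHeight h ρ α L ζ / ρ) := by
    rw [axisHeight]; field_simp
  have hcurve := D.curve_add (-smoothPoint h ρ α ζ)
  rw [neg_add_eq_sub, D.curve_neg] at hcurve
  have hg : 2 * (1 / ρ * h ζ) / Real.cos ((n + 1 / 2) * μ)
      = 1 / ρ * (2 * h ζ / Real.cos ((n + 1 / 2) * μ)) := by ring
  have hcirc (c : ℝ) := Real.sin_sq_add_cos_sq c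
  refine D.hasEllipticPeriodicOrbit n (σ := smoothPoint h ρ α ζ) (φ := (n + 1 / 2) * μ)
    (β := μ - restAngle h ρ α L ζ / (n + 1 / 2)) (β' := μ + restAngle h ρ α L ζ / (n + 1 / 2))
    (e := ρ * tangentDist (axisDistance h ρ α L ζ / ρ - centreDistance h ρ α L / ρ / 2)
      (axisHeight h ρ α L ζ / ρ) ((n + 1 / 2) * μ - restAngle h ρ α L ζ))
    (e' := ρ * tangentDist (-(axisDistance h ρ α L ζ / ρ) - centreDistance h ρ α L / ρ / 2)
      (axisHeight h ρ α L ζ / ρ) ((n + 1 / 2) * μ + restAngle h ρ α L ζ))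
    hO.lower_pos hO.lower_lt hO.upper_pos hO.upper_lt
    (mul_lt_mul_of_pos_left hO.lower_arc hρ) (mul_lt_mul_of_pos_left hO.upper_arc hρ) b1 b2
    hO.incidence (mul_pos hρ hO.dist_pos) (mul_pos hρ hO.dist_pos') ?_ ?_ ?_ ?_ ?_ ?_
  · rw [m1, restAngle]; ring
  · rw [m2, restAngle]; ring
  · rw [m1, ← t1]
    apply Complex.ext
    · rw [Complex.add_re, Complex.ofReal_re, hX]
      simp only [unitVec_re, unitVec_im, Complex.add_re, Complex.mul_re, Complex.mul_im,
        Complex.ofReal_re, Complex.ofReal_im, Complex.I_re, Complex.I_im, tangentDist]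
      linear_combination (-ρ * (axisDistance h ρ α L ζ / ρ - centreDistance h ρ α L / ρ / 2))
        * hcirc ((n + 1 / 2) * μ - restAngle h ρ α L ζ)
    · rw [Complex.add_im, Complex.ofReal_im, hY]
      simp only [unitVec_re, unitVec_im, Complex.add_im, Complex.mul_re, Complex.mul_im,
        Complex.ofReal_re, Complex.ofReal_im, Complex.I_re, Complex.I_im, tangentDist]
      linear_combination (-ρ * (axisHeight h ρ α L ζ / ρ))
        * hcirc ((n + 1 / 2) * μ - restAngle h ρ α L ζ)
  · rw [m2, ← t2, hcurve]
    apply Complex.ext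
    · rw [Complex.add_re, Complex.ofReal_re, Complex.sub_re, Complex.conj_re, hX']
      simp only [unitVec_re, unitVec_im, Complex.add_re, Complex.mul_re, Complex.mul_im,
        Complex.ofReal_re, Complex.ofReal_im, Complex.I_re, Complex.I_im, tangentDist]
      linear_combination (-ρ * (-(axisDistance h ρ α L ζ / ρ) - centreDistance h ρ α L / ρ / 2))
        * hcirc ((n + 1 / 2) * μ + restAngle h ρ α L ζ)
    · rw [Complex.add_im, Complex.ofReal_im, Complex.sub_im, Complex.conj_im, D.curve_period_im, hY]
      simp only [unitVec_re, unitVec_im, Complex.add_im, Complex.mul_re, Complex.mul_im,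
        Complex.ofReal_re, Complex.ofReal_im, Complex.I_re, Complex.I_im, tangentDist]
      linear_combination (-ρ * (axisHeight h ρ α L ζ / ρ))
        * hcirc ((n + 1 / 2) * μ + restAngle h ρ α L ζ)
  · rw [hκ, hg, returnTrace_scale n hρ.ne', arcUpper_scale n hρ.ne', arcUpper_scale n hρ.ne',
      ← mul_sub, mul_pow, mul_pow]
    exact mul_lt_mul_of_pos_left hO.trace_lower (by positivity)
  · rw [hκ, hg, returnTrace_scale n hρ.ne', arcUpper_scale n hρ.ne', arcUpper_scale n hρ.ne',
      ← mul_add, mul_pow, mul_pow]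
    exact mul_lt_mul_of_pos_left hO.trace_upper (by positivity)

end StadiumData

/-! ### Existence of the periodic orbit -/

/-- Two equations in a rectangle, one of which is strictly monotone in the second variable. -/
theorem exists_common_zero {F G : ℝ → ℝ → ℝ} {a b c d : ℝ} (hab : a ≤ b) (hcd : c ≤ d)
    (hF : Continuous fun p : ℝ × ℝ => F p.1 p.2) (hG : Continuous fun p : ℝ × ℝ => G p.1 p.2)
    (hmono : ∀ x ∈ Icc a b, StrictMonoOn (F x) (Icc c d))
    (hFc : ∀ x ∈ Icc a b, F x c < 0) (hFd : ∀ x ∈ Icc a b, 0 < F x d)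
    (hGa : ∀ y ∈ Icc c d, G a y < 0) (hGb : ∀ y ∈ Icc c d, 0 < G b y) :
    ∃ x ∈ Icc a b, ∃ y ∈ Icc c d, F x y = 0 ∧ G x y = 0 := by
  have hcont : ∀ x, Continuous (F x) := fun x =>
    hF.comp (continuous_const.prodMk continuous_id)
  have hcont' : ∀ y, Continuous fun x => F x y := fun y =>
    hF.comp (continuous_id.prodMk continuous_const)
  have hex : ∀ x : Icc a b, ∃ y ∈ Icc c d, F x y = 0 := fun x =>
    intermediate_value_Icc hcd (hcont x).continuousOn ⟨(hFc x x.2).le, (hFd x x.2).le⟩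
  choose y hy hy0 using hex
  -- The zero in the second variable is unique, and the sign of `F` at a fixed level `u` persists
  -- for nearby `x'`; by monotonicity this traps `y x'`. The intermediate value theorem along this
  -- graph then finishes.
  have hyc : Continuous y := by
    rw [continuous_iff_continuousAt]
    intro x
    refine tendsto_order.2 ⟨fun u hu => ?_, fun u hu => ?_⟩
    · rcases lt_or_ge u c with h | h
      · exact Filter.Eventually.of_forall fun x' => h.trans_le (hy x').1
      · have hu' : u ∈ Icc c d := ⟨h, hu.le.trans (hy x).2⟩
        have hneg : F x u < 0 := by rw [← hy0 x]; exact hmono x x.2 hu' (hy x) hu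
        have : ∀ᶠ x' : Icc a b in nhds x, F x' u < 0 :=
          ((hcont' u).comp continuous_subtype_val).continuousAt.eventually_lt
            continuousAt_const hneg
        filter_upwards [this] with x' hx'
        rw [← hy0 x'] at hx'
        exact ((hmono x' x'.2).lt_iff_lt hu' (hy x')).1 hx'
    · rcases lt_or_ge d u with h | h
      · exact Filter.Eventually.of_forall fun x' => (hy x').2.trans_lt h
      · have hu' : u ∈ Icc c d := ⟨(hy x).1.trans hu.le, h⟩
        have hpos : 0 < F x u := by rw [← hy0 x]; exact hmono x x.2 (hy x) hu' hu
        have : ∀ᶠ x' : Icc a b in nhds x, 0 < F x' u :=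
          continuousAt_const.eventually_lt
            ((hcont' u).comp continuous_subtype_val).continuousAt hpos
        filter_upwards [this] with x' hx'
        rw [← hy0 x'] at hx'
        exact ((hmono x' x'.2).lt_iff_lt (hy x') hu').1 hx'
  have hGy : Continuous fun x : Icc a b => G x (y x) :=
    hG.comp (continuous_subtype_val.prodMk hyc)
  have : PreconnectedSpace (Icc a b) := Subtype.preconnectedSpace isPreconnected_Icc
  obtain ⟨x, hx⟩ := mem_range_of_exists_le_of_exists_ge hGy
    ⟨⟨a, left_mem_Icc.2 hab⟩, (hGa _ (hy _)).le⟩ ⟨⟨b, right_mem_Icc.2 hab⟩, (hGb _ (hy _)).le⟩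
  exact ⟨x, x.2, y x, hy x, hy0 x, hx⟩

/-! ### The limiting regular polygon -/

/-- The limit of the angle between consecutive collisions on the circular arcs. -/
noncomputable def baseAngle (n : ℕ) : ℝ := Real.pi / (2 * (n + 1))

theorem baseAngle_pos (n : ℕ) : 0 < baseAngle n := by unfold baseAngle; positivity

/-- The incidence angle at the exceptional collision equals the one on the arcs, as in a regular
polygon with `4 n + 4` vertices. -/
theorem half_mul_baseAngle (n : ℕ) :
    ((n : ℝ) + 1 / 2) * baseAngle n = Real.pi / 2 - baseAngle n / 2 := by
  unfold baseAngle; field_simp; ring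

theorem baseAngle_le (n : ℕ) : baseAngle n ≤ Real.pi / 2 := by
  have := half_mul_baseAngle n
  have h2 := mul_nonneg (Nat.cast_nonneg n : (0 : ℝ) ≤ n) (baseAngle_pos n).le
  linarith

theorem cos_half_mul_baseAngle (n : ℕ) :
    Real.cos ((n + 1 / 2) * baseAngle n) = Real.sin (baseAngle n / 2) := by
  rw [half_mul_baseAngle, Real.cos_pi_div_two_sub]

theorem sin_baseAngle_pos (n : ℕ) : 0 < Real.sin (baseAngle n / 2) :=
  Real.sin_pos_of_pos_of_lt_pi (by linarith [baseAngle_pos n])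
    (by linarith [baseAngle_le n, Real.pi_pos])

theorem continuousAt_arcUpper {X : Type*} [TopologicalSpace X] {r e : X → ℝ} {p : X} (n : ℕ)
    (hr : ContinuousAt r p) (he : ContinuousAt e p) (h0 : r p ≠ 0) :
    ContinuousAt (fun x => arcUpper n (r x) (e x)) p := by
  unfold arcUpper
  exact he.mul (continuousAt_const.add (he.mul (continuousAt_const.div hr h0)))

theorem continuousAt_arcDiag {X : Type*} [TopologicalSpace X] {r e : X → ℝ} {p : X} (n : ℕ)
    (hr : ContinuousAt r p) (he : ContinuousAt e p) (h0 : r p ≠ 0) :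
    ContinuousAt (fun x => arcDiag n (r x) (e x)) p := by
  unfold arcDiag
  exact continuousAt_const.add (he.mul (continuousAt_const.div hr h0))

/-- All conditions are open, so they need checking only at the limit, where `e = r = sin (baseAngle
n / 2)` on both sides. There `R = B (8 n + 6 - 4 k₀ (2 n + 2))`, with `B` the common `arcUpper` and
`R` the `returnTrace`. The bound `R² < 4 B²` amounts to `h1` and `h2`, and `0 < R²` to `h3`. -/
theorem eventually_orbitCondition (n : ℕ) {k₀ : ℝ} (h1 : (2 * n + 1 : ℝ) / (2 * n + 2) < k₀)
    (h2 : k₀ < 1) (h3 : k₀ ≠ (2 * n + 3 / 2 : ℝ) / (2 * n + 2)) :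
    ∀ᶠ p : ℝ × ℝ × ℝ × ℝ × ℝ × ℝ × ℝ in nhds (0, 0, 1, 0, baseAngle n, k₀, 0),
      OrbitCondition n p.1 p.2.1 p.2.2.1 p.2.2.2.1 p.2.2.2.2.1 p.2.2.2.2.2.1 p.2.2.2.2.2.2 := by
  set p₀ : ℝ × ℝ × ℝ × ℝ × ℝ × ℝ × ℝ := (0, 0, 1, 0, baseAngle n, k₀, 0) with hp₀
  have hb := baseAngle_pos n
  have hb2 := baseAngle_le n
  have hπ := Real.pi_pos
  have hm : (0 : ℝ) < n + 1 / 2 := by positivity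
  have hs := sin_baseAngle_pos n
  have hmb := half_mul_baseAngle n
  have clo : ContinuousAt (fun p : ℝ × ℝ × ℝ × ℝ × ℝ × ℝ × ℝ =>
      p.2.2.2.2.1 - p.2.2.2.1 / (n + 1 / 2)) p₀ := by fun_prop
  have cup : ContinuousAt (fun p : ℝ × ℝ × ℝ × ℝ × ℝ × ℝ × ℝ =>
      p.2.2.2.2.1 + p.2.2.2.1 / (n + 1 / 2)) p₀ := by fun_prop
  have cα : ContinuousAt (fun p : ℝ × ℝ × ℝ × ℝ × ℝ × ℝ × ℝ =>
      Real.pi / 2 - p.2.2.2.2.2.2) p₀ := by fun_prop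
  have cφ : ContinuousAt (fun p : ℝ × ℝ × ℝ × ℝ × ℝ × ℝ × ℝ =>
      (n + 1 / 2) * p.2.2.2.2.1) p₀ := by fun_prop
  have ce : ContinuousAt (fun p : ℝ × ℝ × ℝ × ℝ × ℝ × ℝ × ℝ =>
      tangentDist (p.1 - p.2.1 / 2) p.2.2.1 ((n + 1 / 2) * p.2.2.2.2.1 - p.2.2.2.1)) p₀ := by
    unfold tangentDist; fun_prop
  have ce' : ContinuousAt (fun p : ℝ × ℝ × ℝ × ℝ × ℝ × ℝ × ℝ =>
      tangentDist (-p.1 - p.2.1 / 2) p.2.2.1 ((n + 1 / 2) * p.2.2.2.2.1 + p.2.2.2.1)) p₀ := by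
    unfold tangentDist; fun_prop
  have cr : ContinuousAt (fun p : ℝ × ℝ × ℝ × ℝ × ℝ × ℝ × ℝ =>
      Real.sin ((p.2.2.2.2.1 - p.2.2.2.1 / (n + 1 / 2)) / 2)) p₀ := by fun_prop
  have cr' : ContinuousAt (fun p : ℝ × ℝ × ℝ × ℝ × ℝ × ℝ × ℝ =>
      Real.sin ((p.2.2.2.2.1 + p.2.2.2.1 / (n + 1 / 2)) / 2)) p₀ := by fun_prop
  have ccos : ContinuousAt (fun p : ℝ × ℝ × ℝ × ℝ × ℝ × ℝ × ℝ =>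
      Real.cos ((n + 1 / 2) * p.2.2.2.2.1)) p₀ := by fun_prop
  have ck : ContinuousAt (fun p : ℝ × ℝ × ℝ × ℝ × ℝ × ℝ × ℝ => 2 * p.2.2.2.2.2.1) p₀ := by fun_prop
  have cg := ck.div ccos (by
    simp only [hp₀]; rw [cos_half_mul_baseAngle]; exact hs.ne')
  have r0 : Real.sin ((p₀.2.2.2.2.1 - p₀.2.2.2.1 / (n + 1 / 2)) / 2) ≠ 0 := by
    simpa [hp₀] using hs.ne'
  have r0' : Real.sin ((p₀.2.2.2.2.1 + p₀.2.2.2.1 / (n + 1 / 2)) / 2) ≠ 0 := by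
    simpa [hp₀] using hs.ne'
  have cB := continuousAt_arcUpper n cr ce r0
  have cB' := continuousAt_arcUpper n cr' ce' r0'
  have cA := continuousAt_arcDiag n cr ce r0
  have cA' := continuousAt_arcDiag n cr' ce' r0'
  have cR := ((((cA.mul cB').add (cA'.mul cB)).sub ((cg.mul cB).mul cB')).pow 2)
  have e0 : tangentDist 0 1 ((n + 1 / 2) * baseAngle n) = Real.sin (baseAngle n / 2) := by
    rw [tangentDist, cos_half_mul_baseAngle]; ring
  have B0 : arcUpper n (Real.sin (baseAngle n / 2)) (Real.sin (baseAngle n / 2))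
      = Real.sin (baseAngle n / 2) * (4 * n + 4) := by
    unfold arcUpper; field_simp; ring
  have A0 : arcDiag n (Real.sin (baseAngle n / 2)) (Real.sin (baseAngle n / 2)) = 4 * n + 3 := by
    unfold arcDiag; field_simp; ring
  have t1 : k₀ * (2 * n + 2) > 2 * n + 1 := by rwa [div_lt_iff₀ (by positivity)] at h1
  have t3 : k₀ * (2 * n + 2) ≠ 2 * n + 3 / 2 := fun hk => h3 (by rw [← hk]; field_simp)
  have hval : Real.sin (baseAngle n / 2) ≠ 0 := hs.ne'
  have R0 : (4 * (n : ℝ) + 3) * (Real.sin (baseAngle n / 2) * (4 * n + 4))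
      + (4 * n + 3) * (Real.sin (baseAngle n / 2) * (4 * n + 4))
      - 2 * k₀ / Real.sin (baseAngle n / 2) * (Real.sin (baseAngle n / 2) * (4 * n + 4))
        * (Real.sin (baseAngle n / 2) * (4 * n + 4))
      = Real.sin (baseAngle n / 2) * (4 * n + 4) * (8 * n + 6 - 4 * (k₀ * (2 * n + 2))) := by
    field_simp; ring
  have hB0 : 0 < Real.sin (baseAngle n / 2) * (4 * n + 4) := by positivity
  filter_upwards [(continuousAt_const (y := (0 : ℝ))).eventually_lt clo (by simpa [hp₀] using hb),
    clo.eventually_lt (continuousAt_const (y := Real.pi)) (by simp [hp₀]; linarith),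
    (continuousAt_const (y := (0 : ℝ))).eventually_lt cup (by simpa [hp₀] using hb),
    cup.eventually_lt (continuousAt_const (y := Real.pi)) (by simp [hp₀]; linarith),
    (clo.const_mul (n : ℝ)).eventually_lt cα (by simp [hp₀]; linarith),
    (cup.const_mul (n : ℝ)).eventually_lt cα (by simp [hp₀]; linarith),
    cφ.abs.eventually_lt (continuousAt_const (y := Real.pi / 2)) (by
      simp only [hp₀]; rw [hmb, abs_lt]; constructor <;> linarith),
    (continuousAt_const (y := (0 : ℝ))).eventually_lt ce (by
      simp only [hp₀, zero_div, sub_zero]; rw [e0]; exact hs),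
    (continuousAt_const (y := (0 : ℝ))).eventually_lt ce' (by
      simp only [hp₀, zero_div, sub_zero, neg_zero, add_zero]; rw [e0]; exact hs),
    ((cB.sub cB').pow 2).eventually_lt cR (by
      simp only [hp₀, zero_div, sub_zero, neg_zero, add_zero, Pi.sub_apply, Pi.pow_apply,
        Pi.mul_apply, Pi.add_apply, Pi.div_apply]
      rw [e0, cos_half_mul_baseAngle, B0, A0, R0, sub_self, zero_pow two_ne_zero]
      have : 8 * (n : ℝ) + 6 - 4 * (k₀ * (2 * n + 2)) ≠ 0 := fun h0 => t3 (by linarith)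
      positivity),
    cR.eventually_lt ((cB.add cB').pow 2) (by
      simp only [hp₀, zero_div, sub_zero, neg_zero, add_zero, Pi.sub_apply, Pi.pow_apply,
        Pi.mul_apply, Pi.add_apply, Pi.div_apply]
      rw [e0, cos_half_mul_baseAngle, B0, A0, R0, ← mul_two, mul_pow, mul_pow _ (2 : ℝ)]
      refine mul_lt_mul_of_pos_left ?_ (by positivity)
      have : k₀ * (2 * n + 2) < 2 * n + 2 := by
        have : (0 : ℝ) < 2 * n + 2 := by positivity
        nlinarith
      rw [sq_lt_sq, abs_two, abs_lt]
      constructor <;> linarith)]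
    with p q1 q2 q3 q4 q5 q6 q7 q8 q9 q10 q11
  exact ⟨q1, q2, q3, q4, q5, q6, q7, q8, q9, q10, q11⟩

/-- Every term is monotone in `μ` as long as `(n + 1/2) μ` stays in `[0, π/2]`; the sine term with
factor `b` is strictly so. -/
theorem tangencySum_strictMonoOn (n : ℕ) {x w b η c d : ℝ} (hx : 0 ≤ x) (hw : 0 ≤ w) (hb : 0 < b)
    (hη : 0 ≤ η) (hη' : η < Real.pi / 2) (hc : 0 ≤ c) (hd : (n + 1 / 2) * d ≤ Real.pi / 2) :
    StrictMonoOn (tangencySum n x w b η) (Icc c d) := by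
  intro u hu v hv huv
  have hn : (0 : ℝ) ≤ n := Nat.cast_nonneg n
  have hm : (0 : ℝ) < n + 1 / 2 := by positivity
  have hπ := Real.pi_pos
  have m1 : ((n : ℝ) + 1 / 2) * u < (n + 1 / 2) * v := mul_lt_mul_of_pos_left huv hm
  have m2 : ((n : ℝ) + 1 / 2) * v ≤ (n + 1 / 2) * d := mul_le_mul_of_nonneg_left hv.2 hm.le
  have m0 : 0 ≤ ((n : ℝ) + 1 / 2) * u := mul_nonneg hm.le (hc.trans hu.1)
  have hvπ : v ≤ Real.pi := by nlinarith [hc.trans hv.1]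
  have s1 : Real.sin ((n + 1 / 2) * u) < Real.sin ((n + 1 / 2) * v) :=
    Real.sin_lt_sin_of_lt_of_le_pi_div_two (by linarith) (by linarith) m1
  have s2 : Real.cos ((n + 1 / 2) * v) ≤ Real.cos ((n + 1 / 2) * u) :=
    Real.cos_le_cos_of_nonneg_of_le_pi m0 (by linarith) m1.le
  have s3 : Real.cos (v / 2) < Real.cos (u / 2) :=
    Real.cos_lt_cos_of_nonneg_of_le_pi (by linarith [hu.1]) (by linarith) (by linarith)
  have hle : η / (n + 1 / 2) / 2 ≤ η := by
    rw [div_div]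
    exact div_le_self hη (by linarith)
  have hge : 0 ≤ η / (n + 1 / 2) / 2 := by positivity
  have k1 : 0 < Real.cos (η / (n + 1 / 2) / 2) :=
    Real.cos_pos_of_mem_Ioo ⟨by linarith, by linarith⟩
  have k2 : 0 < Real.cos η := Real.cos_pos_of_mem_Ioo ⟨by linarith, by linarith⟩
  have k3 : 0 ≤ Real.sin η := Real.sin_nonneg_of_nonneg_of_le_pi hη (by linarith)
  have a1 := mul_le_mul_of_nonneg_left s1.le (mul_nonneg hx k3)
  have a2 := mul_le_mul_of_nonneg_left s2 (mul_nonneg hw k2.le)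
  have a3 := mul_lt_mul_of_pos_left s1 (mul_pos hb k2)
  have a4 := mul_lt_mul_of_pos_left s3 k1
  unfold tangencySum
  linarith

/-- The limit is `2 sin ((n + 1/2) μ) - 2 sin (π/2 - μ/2)`, and the two arguments coincide exactly
at `baseAngle n`. -/
theorem tangencySum_limit_neg (n : ℕ) {μ : ℝ} (h0 : 0 ≤ μ) (h : μ < baseAngle n) :
    tangencySum n 0 0 1 0 μ < 0 := by
  have hπ := Real.pi_pos
  have hn : (0 : ℝ) ≤ n := Nat.cast_nonneg n
  have h1 : ((n : ℝ) + 1 / 2) * μ < Real.pi / 2 - μ / 2 := by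
    have := half_mul_baseAngle n
    nlinarith
  have := Real.sin_lt_sin_of_lt_of_le_pi_div_two (x := (n + 1 / 2) * μ) (y := Real.pi / 2 - μ / 2)
    (by nlinarith) (by linarith) h1
  rw [Real.sin_pi_div_two_sub] at this
  simp [tangencySum]
  simp at this
  linarith

theorem tangencySum_limit_pos (n : ℕ) {μ : ℝ} (h : baseAngle n < μ)
    (h2 : (n + 1 / 2) * μ ≤ Real.pi / 2) : 0 < tangencySum n 0 0 1 0 μ := by
  have hπ := Real.pi_pos
  have hn : (0 : ℝ) ≤ n := Nat.cast_nonneg n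
  have hμ := (baseAngle_pos n).trans h
  have h1 : Real.pi / 2 - μ / 2 < ((n : ℝ) + 1 / 2) * μ := by
    have := half_mul_baseAngle n
    nlinarith
  have hμπ : μ ≤ Real.pi := by nlinarith
  have := Real.sin_lt_sin_of_lt_of_le_pi_div_two (x := Real.pi / 2 - μ / 2) (y := (n + 1 / 2) * μ)
    (by linarith) h2 h1
  rw [Real.sin_pi_div_two_sub] at this
  simp [tangencySum]
  simp at this
  linarith

/-! ### The difference equation at order `α` -/

theorem mul_sinc (x : ℝ) : x * Real.sinc x = Real.sin x := by
  by_cases hx : x = 0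
  · simp [hx]
  · rw [Real.sinc_of_ne_zero hx]; field_simp

/-- The difference of the tangency conditions, divided by `α`. -/
noncomputable def scaledDiff (n : ℕ) (J x w b α μ : ℝ) : ℝ :=
  2 * x * Real.cos ((n + 1 / 2) * μ) * Real.cos (α * J)
    - w * Real.sin ((n + 1 / 2) * μ) * (J * Real.sinc (α * J))
    - 2 * b * Real.cos ((n + 1 / 2) * μ) * (J * Real.sinc (α * J))
    - 2 * Real.sin (μ / 2) * (J / (n + 1 / 2) / 2 * Real.sinc (α * J / (n + 1 / 2) / 2))

/-- Both the position and the rest angle have order `α`. Writing sines through `sinc` removes the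
factor `α` and leaves a function that is continuous also at `α = 0`. -/
theorem tangencyDiff_eq (n : ℕ) (J x w b α μ : ℝ) :
    tangencyDiff n (α * x) w b (α * J) μ = α * scaledDiff n J x w b α μ := by
  unfold tangencyDiff scaledDiff
  rw [← mul_sinc (α * J), ← mul_sinc (α * J / (n + 1 / 2) / 2)]
  ring

/-- For `x = (1 - ζ) / I` and `J = (∫_ζ^1 h) / I`, where `I` is the integral of `h` over `[0, 1]`,
the last factor vanishes exactly when the equation in (C) holds. -/
theorem scaledDiff_limit (n : ℕ) (J x : ℝ) :
    scaledDiff n J x 0 1 0 (baseAngle n)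
      = 2 * Real.sin (baseAngle n / 2) / ((2 * n + 1) / (2 * n + 2))
        * ((2 * n + 1) / (2 * n + 2) * x - J) := by
  unfold scaledDiff
  rw [cos_half_mul_baseAngle]
  simp
  field_simp
  ring

theorem eventually_scaledDiff (n : ℕ) (J x₀ : ℝ) (P : ℝ → Prop) (hP : IsOpen {t | P t})
    (h : P (scaledDiff n J x₀ 0 1 0 (baseAngle n))) :
    ∀ᶠ p : ℝ × ℝ × ℝ × ℝ × ℝ in nhds (x₀, 0, 1, 0, baseAngle n),
      P (scaledDiff n J p.1 p.2.1 p.2.2.1 p.2.2.2.1 p.2.2.2.2) := by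
  have hc : Continuous fun p : ℝ × ℝ × ℝ × ℝ × ℝ =>
      scaledDiff n J p.1 p.2.1 p.2.2.1 p.2.2.2.1 p.2.2.2.2 := by
    unfold scaledDiff
    have := Real.continuous_sinc
    fun_prop
  exact hc.continuousAt.eventually (hP.mem_nhds h)

theorem eventually_tangencySum (n : ℕ) (μ : ℝ) (P : ℝ → Prop) (hP : IsOpen {t | P t})
    (h : P (tangencySum n 0 0 1 0 μ)) :
    ∀ᶠ p : ℝ × ℝ × ℝ × ℝ in nhds (0, 0, 1, 0),
      P (tangencySum n p.1 p.2.1 p.2.2.1 p.2.2.2 μ) := by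
  have hc : Continuous fun p : ℝ × ℝ × ℝ × ℝ =>
      tangencySum n p.1 p.2.1 p.2.2.1 p.2.2.2 μ := by
    unfold tangencySum
    fun_prop
  exact hc.continuousAt.eventually (hP.mem_nhds h)

/-! ### The resonance equation of the shape function -/

theorem antitone_integral_bounds {h : ℝ → ℝ} (hc : ContinuousOn h (Icc 0 1))
    (ha : AntitoneOn h (Icc 0 1)) {a b : ℝ} (h0 : 0 ≤ a) (hab : a ≤ b) (h1 : b ≤ 1) :
    (b - a) * h b ≤ ∫ ξ in a..b, h ξ ∧ ∫ ξ in a..b, h ξ ≤ (b - a) * h a := by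
  have hi : IntervalIntegrable h volume a b :=
    (hc.mono (uIcc_subset_Icc ⟨h0, hab.trans h1⟩ ⟨h0.trans hab, h1⟩)).intervalIntegrable
  have hmem : ∀ x ∈ Icc a b, x ∈ Icc (0 : ℝ) 1 := fun x hx => ⟨h0.trans hx.1, hx.2.trans h1⟩
  have e (c : ℝ) : ∫ _ξ in a..b, c = (b - a) * c := by simp
  rw [← e (h b), ← e (h a)]
  exact ⟨intervalIntegral.integral_mono_on hab intervalIntegrable_const hi fun x hx =>
      ha (hmem x hx) (hmem b (right_mem_Icc.2 hab)) hx.2,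
    intervalIntegral.integral_mono_on hab hi intervalIntegrable_const fun x hx =>
      ha (hmem a (left_mem_Icc.2 hab)) (hmem x hx) hx.1⟩

theorem integral_tail_split {h : ℝ → ℝ} (hc : ContinuousOn h (Icc 0 1)) {a b : ℝ}
    (h0 : 0 ≤ a) (hab : a ≤ b) (h1 : b ≤ 1) :
    ∫ ξ in a..1, h ξ = (∫ ξ in a..b, h ξ) + ∫ ξ in b..1, h ξ :=
  (intervalIntegral.integral_add_adjacent_intervals
    (hc.mono (uIcc_subset_Icc ⟨h0, hab.trans h1⟩ ⟨h0.trans hab, h1⟩)).intervalIntegrable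
    (hc.mono (uIcc_subset_Icc ⟨h0.trans hab, h1⟩ (by simp))).intervalIntegrable).symm

/-- The resonance condition has a solution in the open unit interval. -/
theorem exists_resonance {h : ℝ → ℝ} (hc : ContinuousOn h (Icc 0 1))
    (ha : AntitoneOn h (Icc 0 1)) (h1 : h 1 = 0) {κ : ℝ} (hκ : 0 < κ)
    (hI : κ < ∫ ξ in (0 : ℝ)..1, h ξ) :
    ∃ ζ ∈ Ioo (0 : ℝ) 1, κ * (1 - ζ) = (∫ ξ in ζ..1, h ξ) ∧ κ < h ζ := by
  -- The resonance function `S` vanishes trivially at 1. Stopping at a point `ζ₁ < 1` with `h ζ₁ <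
  -- κ`, where `S` is negative, excludes that root.
  obtain ⟨ζ₁, hζ₁, hlt⟩ : ∃ ζ₁ ∈ Ioo (0 : ℝ) 1, h ζ₁ < κ := by
    have hcw : ContinuousWithinAt h (Ioo 0 1) 1 :=
      (hc 1 (by simp)).mono Ioo_subset_Icc_self
    have hev := hcw.eventually_lt (continuousWithinAt_const (b := κ)) (by rwa [h1])
    have hne : (nhdsWithin (1 : ℝ) (Ioo 0 1)).NeBot := by
      rw [← mem_closure_iff_nhdsWithin_neBot, closure_Ioo zero_ne_one]; simp
    obtain ⟨x, hx1, hx2⟩ := (hev.and self_mem_nhdsWithin).exists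
    exact ⟨x, hx2, hx1⟩
  set S : ℝ → ℝ := fun ζ => (∫ ξ in ζ..1, h ξ) - κ * (1 - ζ) with hS
  have hSc : ContinuousOn S (Icc 0 1) := by
    have hint : IntegrableOn h (uIcc 0 1) volume := by
      rw [uIcc_of_le zero_le_one]; exact hc.integrableOn_Icc
    have h2 := intervalIntegral.continuousOn_primitive_interval_left (μ := volume) hint
    rw [uIcc_of_le zero_le_one] at h2
    exact h2.sub (by fun_prop)
  have hS1 : S ζ₁ < 0 := by
    have := (antitone_integral_bounds hc ha hζ₁.1.le hζ₁.2.le le_rfl).2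
    have h3 := mul_lt_mul_of_pos_left hlt (sub_pos.2 hζ₁.2)
    simp only [hS]; linarith
  have hS0 : 0 < S 0 := by simp only [hS]; linarith
  obtain ⟨ζ, hζ, hζ0⟩ := intermediate_value_Icc' hζ₁.1.le
    (hSc.mono (Icc_subset_Icc_right hζ₁.2.le)) ⟨hS1.le, hS0.le⟩
  have hne0 : ζ ≠ 0 := by rintro rfl; linarith
  have hζlt : ζ < ζ₁ := lt_of_le_of_ne hζ.2 (by rintro rfl; linarith)
  refine ⟨ζ, ⟨lt_of_le_of_ne hζ.1 hne0.symm, hζlt.trans hζ₁.2⟩, ?_, ?_⟩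
  · simp only [hS] at hζ0; linarith
  -- If `h ζ ≤ κ`, then `h ≤ κ` beyond `ζ`, and `S` could not fall from 0 at `ζ` to a negative value
  -- at `ζ₁`.
  · by_contra! hle
    have e := integral_tail_split hc hζ.1 hζlt.le hζ₁.2.le
    have b1 := (antitone_integral_bounds hc ha hζ.1 hζlt.le hζ₁.2.le).2
    have b2 := mul_le_mul_of_nonneg_left hle (sub_pos.2 hζlt).le
    simp only [hS] at hζ0 hS1
    linarith

/-- The resonance function changes its sign at the solution. -/
theorem resonance_sign {h : ℝ → ℝ} (hc : ContinuousOn h (Icc 0 1))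
    (ha : AntitoneOn h (Icc 0 1)) {κ ζ : ℝ} (hζ : ζ ∈ Ioo (0 : ℝ) 1)
    (hz : κ * (1 - ζ) = ∫ ξ in ζ..1, h ξ) :
    (∀ a, 0 ≤ a → a < ζ → κ < h ζ → κ * (1 - a) < ∫ ξ in a..1, h ξ) ∧
      ∀ b, ζ < b → b ≤ 1 → κ < h b → (∫ ξ in b..1, h ξ) < κ * (1 - b) := by
  -- The tail integral minus `κ (1 - ·)` has slope `κ - h`, which is negative wherever `h > κ`;
  -- since `h` is antitone, a bound at the right endpoint suffices.
  constructor
  · intro a h0 haz hk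
    have e := integral_tail_split hc h0 haz.le hζ.2.le
    have b1 := (antitone_integral_bounds hc ha h0 haz.le hζ.2.le).1
    have b2 := mul_lt_mul_of_pos_left hk (sub_pos.2 haz)
    linarith
  · intro b hzb h1 hk
    have e := integral_tail_split hc hζ.1.le hzb.le h1
    have b1 := (antitone_integral_bounds hc ha hζ.1.le hzb.le h1).1
    have b2 := mul_lt_mul_of_pos_left hk (sub_pos.2 hzb)
    linarith

namespace StadiumData

variable {h : ℝ → ℝ} {ρ α L : ℝ}

/-- Size of the dimensionless parameters for small angles and short separations. -/
theorem parameter_bounds (D : StadiumData h ρ α L) (hI : 1 / 2 ≤ ∫ ξ in (0 : ℝ)..1, h ξ)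
    (hα : α ≤ 1) (hL : L < ρ * α ^ 2) {ζ : ℝ} (hζ : ζ ∈ Icc (0 : ℝ) 1) :
    |axisDistance h ρ α L ζ / ρ / α - (1 - ζ) / ∫ ξ in (0 : ℝ)..1, h ξ| ≤ 5 * α ∧
      0 ≤ axisDistance h ρ α L ζ / ρ ∧ axisDistance h ρ α L ζ / ρ ≤ 5 * α ∧
      0 ≤ centreDistance h ρ α L / ρ ∧ centreDistance h ρ α L / ρ ≤ 5 * α ∧
      0 < axisHeight h ρ α L ζ / ρ ∧ |axisHeight h ρ α L ζ / ρ - 1| ≤ 5 * α := by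
  have hρ := D.radius_pos
  have hα0 := D.angle_pos
  have hL0 := D.separation_nonneg
  have hI0 := D.integral_pos
  obtain ⟨x1, x2⟩ := D.axisDistance_bounds (L := L) hζ
  obtain ⟨b1, b2⟩ := D.axisHeight_bounds (L := L) hζ
  obtain ⟨w1, w2⟩ := D.centreDistance_bounds
  set I := ∫ ξ in (0 : ℝ)..1, h ξ with hIdef
  have hs : smoothenedLength h ρ α = ρ * α / I := rfl
  have hinv : 1 / I ≤ 2 := by rw [div_le_iff₀ hI0]; linarith
  have hinv0 : 0 < 1 / I := by positivity
  set l := L / ρ with hl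
  have hl0 : 0 ≤ l := by positivity
  -- The separation is of second order, so its contribution to the position vanishes even after
  -- division by `α`.
  have hl1 : l < α ^ 2 := by rw [hl, div_lt_iff₀ hρ]; linarith
  have hLl : L = ρ * l := by rw [hl]; field_simp
  have hs' : smoothenedLength h ρ α = ρ * (α * (1 / I)) := by rw [hs]; ring
  have hcos : 1 - α ^ 2 / 2 ≤ Real.cos α := Real.one_sub_sq_div_two_le_cos
  have hcos1 := Real.cos_le_one α
  have hcos0 : 0 < Real.cos α :=
    Real.cos_pos_of_mem_Ioo ⟨by linarith [Real.pi_pos], D.angle_lt⟩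
  set X := axisDistance h ρ α L ζ / ρ with hX
  have hXe : axisDistance h ρ α L ζ = ρ * X := by rw [hX]; field_simp
  set B := axisHeight h ρ α L ζ / ρ with hB
  have hBe : axisHeight h ρ α L ζ = ρ * B := by rw [hB]; field_simp
  set w := centreDistance h ρ α L / ρ with hw
  have hwe : centreDistance h ρ α L = ρ * w := by rw [hw]; field_simp
  rw [hs', hXe, hLl] at x1 x2
  rw [hBe] at b1
  rw [hs', hBe] at b2
  rw [hwe] at w1
  rw [hs', hwe, hLl] at w2
  set y := α * ((1 - ζ) * (1 / I)) with hy
  have hx0 : 0 ≤ (1 - ζ) * (1 / I) := mul_nonneg (by linarith [hζ.2]) hinv0.le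
  have hx2 : (1 - ζ) * (1 / I) ≤ 2 :=
    (mul_le_of_le_one_left hinv0.le (by linarith [hζ.1])).trans hinv
  have x1' : Real.cos α * (y + l / 2) ≤ X :=
    le_of_mul_le_mul_left (by rw [hy]; linarith) hρ
  have x2' : X ≤ y + l / 2 := le_of_mul_le_mul_left (by rw [hy]; linarith) hρ
  have b1' : Real.cos α ≤ B := le_of_mul_le_mul_left b1 hρ
  have b2' : B ≤ Real.cos α + α * (1 / I) := le_of_mul_le_mul_left (by linarith) hρ
  have w1' : 0 ≤ w := le_of_mul_le_mul_left (by linarith) hρ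
  -- The constant 5 comes from here: with `1 / I ≤ 2` the bound is at most `4 α + α²`.
  have w2' : w ≤ 2 * (α * (1 / I)) + l := le_of_mul_le_mul_left (by linarith) hρ
  have hy0 : 0 ≤ y := mul_nonneg hα0.le hx0
  have hy2 : y ≤ α * 2 := mul_le_mul_of_nonneg_left hx2 hα0.le
  have hsq : α ^ 2 ≤ α := by rw [sq]; exact mul_le_of_le_one_left hα0.le hα
  have hcube : α ^ 2 / 2 * y ≤ α ^ 2 := by
    have := mul_le_mul_of_nonneg_left (show y ≤ 2 by linarith) (show 0 ≤ α ^ 2 / 2 by positivity)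
    linarith
  have hαI : α * (1 / I) ≤ α * 2 := mul_le_mul_of_nonneg_left hinv hα0.le
  refine ⟨?_, ?_, by linarith, w1', by linarith, by linarith, ?_⟩
  · have e : X / α - (1 - ζ) / I = (X - y) / α := by rw [hy]; field_simp
    rw [e, abs_div, abs_of_pos hα0, div_le_iff₀ hα0, abs_le]
    have k1 := mul_le_mul_of_nonneg_right hcos hy0
    have k2 := mul_nonneg hcos0.le hl0
    have k3 : 5 * α * α = 5 * α ^ 2 := by ring
    rw [k3]
    constructor <;> linarith [sq_nonneg α]
  · exact le_trans (by positivity) x1'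
  · rw [abs_le]; constructor <;> linarith

end StadiumData

theorem mainTheorem1 (h : ℝ → ℝ)
    (h_cont : ContinuousOn h (Set.Icc 0 1)) (h_zero : h 0 = 1) (h_one : h 1 = 0)
    (h_anti : AntitoneOn h (Set.Icc 0 1)) (h_lt : ∀ ζ ∈ Set.Ioc (0 : ℝ) 1, h ζ < 1)
    (h_length : ∀ ρ α : ℝ, 0 < ρ → 0 < α → smoothenedLength h ρ α < 2 * (ρ * α))
    (h_C : ShapeNondegenerate h) :
    ∃ α₀ : ℝ, 0 < α₀ ∧ ∀ α : ℝ, 0 < α → α < α₀ → ∀ ρ : ℝ, 0 < ρ →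
      ∃ L₀ : ℝ, 0 < L₀ ∧ ∀ L : ℝ, 0 ≤ L → L < L₀ →
        HasEllipticPeriodicOrbit (stadiumTangentAngle h ρ α L)
          (2 * stadiumHalfPerimeter h ρ α L) := by
  obtain ⟨n, hI, hne⟩ := h_C
  set κ : ℝ := (2 * n + 1 : ℝ) / (2 * n + 2) with hκdef
  have hn : (0 : ℝ) ≤ n := Nat.cast_nonneg n
  have hκ : 0 < κ := by positivity
  have hκ2 : 1 / 2 ≤ κ := by rw [hκdef, div_le_div_iff₀ (by norm_num) (by positivity)]; linarith
  obtain ⟨ζ₀, hζ₀, hz, hkζ⟩ := exists_resonance h_cont h_anti h_one hκ hI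
  have hk1 : h ζ₀ < 1 := h_lt ζ₀ ⟨hζ₀.1, hζ₀.2.le⟩
  have hk3 := hne ζ₀ ⟨hζ₀.1.le, hζ₀.2.le⟩ hz
  set I := ∫ ξ in (0 : ℝ)..1, h ξ with hIdef
  have hI0 : 0 < I := hκ.trans hI
  obtain ⟨δ₁, hδ₁, hO⟩ := Metric.eventually_nhds_iff.1 (eventually_orbitCondition n hkζ hk1 hk3)
  simp only [Prod.dist_eq, Real.dist_eq, max_lt_iff, sub_zero, Prod.forall, and_imp] at hO
  have hcζ : ContinuousAt h ζ₀ := h_cont.continuousAt (Icc_mem_nhds hζ₀.1 hζ₀.2)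
  obtain ⟨ε₁, hε₁, hh⟩ := Metric.continuousAt_iff.1 hcζ (min δ₁ (h ζ₀ - κ))
    (lt_min hδ₁ (sub_pos.2 hkζ))
  simp only [Real.dist_eq, lt_min_iff] at hh
  -- On this window around `ζ₀`, contained in the unit interval, `h` is within `δ₁` of `h ζ₀` and
  -- stays above `κ`.
  set ε := min (ε₁ / 2) (min (ζ₀ / 2) ((1 - ζ₀) / 2)) with hε
  have hε0 : 0 < ε := lt_min (by linarith) (lt_min (by linarith [hζ₀.1]) (by linarith [hζ₀.2]))
  have hεa : ε ≤ ε₁ / 2 := min_le_left _ _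
  have hεb : ε ≤ ζ₀ / 2 := (min_le_right _ _).trans (min_le_left _ _)
  have hεc : ε ≤ (1 - ζ₀) / 2 := (min_le_right _ _).trans (min_le_right _ _)
  have hmem : ∀ ζ ∈ Icc (ζ₀ - ε) (ζ₀ + ε), ζ ∈ Icc (0 : ℝ) 1 := fun ζ hζ =>
    ⟨by linarith [hζ.1, hζ₀.1], by linarith [hζ.2, hζ₀.2]⟩
  have hnear : ∀ ζ ∈ Icc (ζ₀ - ε) (ζ₀ + ε), |h ζ - h ζ₀| < δ₁ ∧ |h ζ - h ζ₀| < h ζ₀ - κ :=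
    fun ζ hζ => hh (by rw [abs_lt]; constructor <;> linarith [hζ.1, hζ.2])
  have hl : ζ₀ - ε ∈ Icc (ζ₀ - ε) (ζ₀ + ε) := ⟨le_rfl, by linarith⟩
  have hr : ζ₀ + ε ∈ Icc (ζ₀ - ε) (ζ₀ + ε) := ⟨by linarith, le_rfl⟩
  obtain ⟨sl, sr⟩ := resonance_sign h_cont h_anti hζ₀ hz
  have sl' := sl (ζ₀ - ε) (hmem _ hl).1 (by linarith) hkζ
  have sr' := sr (ζ₀ + ε) (by linarith) (hmem _ hr).2 (by
    linarith [(abs_lt.1 (hnear _ hr).2).1])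
  have hs := sin_baseAngle_pos n
  have hfac : 0 < 2 * Real.sin (baseAngle n / 2) / κ := by positivity
  have hGl : scaledDiff n ((∫ ξ in (ζ₀ - ε)..1, h ξ) / I) ((1 - (ζ₀ - ε)) / I) 0 1 0 (baseAngle n)
      < 0 := by
    rw [scaledDiff_limit]
    refine mul_neg_of_pos_of_neg hfac ?_
    rw [← mul_div_assoc, ← sub_div]
    exact div_neg_of_neg_of_pos (sub_neg.2 sl') hI0
  have hGr : 0 < scaledDiff n ((∫ ξ in (ζ₀ + ε)..1, h ξ) / I) ((1 - (ζ₀ + ε)) / I) 0 1 0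
      (baseAngle n) := by
    rw [scaledDiff_limit]
    refine mul_pos hfac ?_
    rw [← mul_div_assoc, ← sub_div]
    exact div_pos (sub_pos.2 sr') hI0
  obtain ⟨δ₂, hδ₂, hG₂⟩ := Metric.eventually_nhds_iff.1
    (eventually_scaledDiff n _ _ (· < 0) isOpen_Iio hGl)
  obtain ⟨δ₃, hδ₃, hG₃⟩ := Metric.eventually_nhds_iff.1
    (eventually_scaledDiff n _ _ (0 < ·) isOpen_Ioi hGr)
  simp only [Prod.dist_eq, Real.dist_eq, max_lt_iff, sub_zero, Prod.forall, and_imp] at hG₂ hG₃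
  have hbase := baseAngle_pos n
  -- The bound `baseAngle n / (2 * (n + 1))` keeps incidence angles up to `(n + 1/2) (baseAngle n +
  -- δ)` at most `π/2`, the range in which the tangency sum is monotone; halving makes all bounds
  -- strict.
  set δ := min (min δ₁ (min δ₂ δ₃)) (baseAngle n / (2 * (n + 1))) / 2 with hδ
  have hq : 0 < baseAngle n / (2 * (n + 1)) := by positivity
  have hδ0 : 0 < δ := half_pos (lt_min (lt_min hδ₁ (lt_min hδ₂ hδ₃)) hq)
  have hmin : δ < min (min δ₁ (min δ₂ δ₃)) (baseAngle n / (2 * (n + 1))) := half_lt_self (by linarith)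
  simp only [lt_min_iff] at hmin
  obtain ⟨⟨hd1, hd2, hd3⟩, hd4⟩ := hmin
  rw [lt_div_iff₀ (by positivity)] at hd4
  have hδn : 0 ≤ δ * n := by positivity
  have hμ1 : 0 ≤ baseAngle n - δ := by nlinarith
  have hμ2 : ((n : ℝ) + 1 / 2) * (baseAngle n + δ) ≤ Real.pi / 2 := by
    rw [mul_add, half_mul_baseAngle]; linarith
  obtain ⟨δ₄, hδ₄, hF₄⟩ := Metric.eventually_nhds_iff.1
    (eventually_tangencySum n (baseAngle n - δ) (· < 0) isOpen_Iio
      (tangencySum_limit_neg n hμ1 (by linarith)))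
  obtain ⟨δ₅, hδ₅, hF₅⟩ := Metric.eventually_nhds_iff.1
    (eventually_tangencySum n (baseAngle n + δ) (0 < ·) isOpen_Ioi
      (tangencySum_limit_pos n (by linarith) hμ2))
  simp only [Prod.dist_eq, Real.dist_eq, max_lt_iff, sub_zero, Prod.forall, and_imp] at hF₄ hF₅
  set m := min 1 (min δ₁ (min δ₂ (min δ₃ (min δ₄ δ₅)))) with hm
  have hm0 : 0 < m := by simp only [hm, lt_min_iff]; exact ⟨one_pos, hδ₁, hδ₂, hδ₃, hδ₄, hδ₅⟩
  -- All dimensionless parameters deviate from their limits by at most `5 α`, hence `m / 5`. The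
  -- threshold `ρ α²` makes the separation negligible at order `α`.
  refine ⟨m / 5, by linarith, fun α hα hαm ρ hρ => ⟨ρ * α ^ 2, by positivity, fun L hL hLlt => ?_⟩⟩
  have hα5 : 5 * α < m := by linarith
  have hα5' := hα5
  simp only [hm, lt_min_iff] at hα5'
  obtain ⟨a0, a1, a2, a3, a4, a5⟩ := hα5'
  have hαle : α ≤ 1 := by linarith
  have hαπ : α < Real.pi / 2 := by linarith [Real.pi_gt_three]
  have D : StadiumData h ρ α L :=
    ⟨h_cont, h_anti, h_zero, h_one, hI0, hρ, hα, hαπ, hL⟩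
  have hpar := fun {ζ : ℝ} (hζ : ζ ∈ Icc (ζ₀ - ε) (ζ₀ + ε)) =>
    D.parameter_bounds (hκ2.trans hI.le) hαle hLlt (hmem ζ hζ)
  have hrest := fun {ζ : ℝ} (hζ : ζ ∈ Icc (ζ₀ - ε) (ζ₀ + ε)) =>
    D.restAngle_bounds (L := L) (hmem ζ hζ)
  have abs0 : ∀ {t : ℝ}, 0 ≤ t → t ≤ 5 * α → ∀ {d : ℝ}, 5 * α < d → |t| < d :=
    fun {t} h0 h5 {d} hd => by rw [abs_of_nonneg h0]; linarith
  have hdiff : ∀ ζ μ, ζ ∈ Icc (ζ₀ - ε) (ζ₀ + ε) →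
      tangencyDiff n (axisDistance h ρ α L ζ / ρ) (centreDistance h ρ α L / ρ)
        (axisHeight h ρ α L ζ / ρ) (restAngle h ρ α L ζ) μ
      = α * scaledDiff n ((∫ ξ in ζ..1, h ξ) / I) (axisDistance h ρ α L ζ / ρ / α)
        (centreDistance h ρ α L / ρ) (axisHeight h ρ α L ζ / ρ) α μ := fun ζ μ hζ => by
    rw [← tangencyDiff_eq, mul_div_cancel₀ _ hα.ne', D.restAngle_eq (hmem ζ hζ)]
  -- The tangency sum changes sign across the range of `μ` for every `ζ`, and the tangency
  -- difference across the range of `ζ` for every `μ`.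
  obtain ⟨ζ, hζ, μ, hμ, hsum, hdif⟩ := exists_common_zero
    (F := fun ζ μ => tangencySum n (axisDistance h ρ α L ζ / ρ) (centreDistance h ρ α L / ρ)
        (axisHeight h ρ α L ζ / ρ) (restAngle h ρ α L ζ) μ)
    (G := fun ζ μ => tangencyDiff n (axisDistance h ρ α L ζ / ρ) (centreDistance h ρ α L / ρ)
        (axisHeight h ρ α L ζ / ρ) (restAngle h ρ α L ζ) μ)
    (a := ζ₀ - ε) (b := ζ₀ + ε) (c := baseAngle n - δ) (d := baseAngle n + δ)
    (by linarith) (by linarith)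
    (by
      have c1 := D.continuous_axisDistance
      have c2 := D.continuous_axisHeight
      have c3 := D.continuous_restAngle
      unfold tangencySum
      fun_prop)
    (by
      have c1 := D.continuous_axisDistance
      have c2 := D.continuous_axisHeight
      have c3 := D.continuous_restAngle
      unfold tangencyDiff
      fun_prop)
    (fun ζ hζ => by
      obtain ⟨-, p2, -, p4, -, p6, -⟩ := hpar hζ
      obtain ⟨r1, r2⟩ := hrest hζ
      exact tangencySum_strictMonoOn n p2 p4 p6 r1 (by linarith) hμ1 hμ2)
    (fun ζ hζ => by
      obtain ⟨-, p2, p3, p4, p5, -, p7⟩ := hpar hζ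
      obtain ⟨r1, r2⟩ := hrest hζ
      exact hF₄ _ _ _ _ (abs0 p2 p3 a4) (abs0 p4 p5 a4) (p7.trans_lt a4)
        (abs0 r1 (by linarith) a4))
    (fun ζ hζ => by
      obtain ⟨-, p2, p3, p4, p5, -, p7⟩ := hpar hζ
      obtain ⟨r1, r2⟩ := hrest hζ
      exact hF₅ _ _ _ _ (abs0 p2 p3 a5) (abs0 p4 p5 a5) (p7.trans_lt a5)
        (abs0 r1 (by linarith) a5))
    (fun μ hμ => by
      obtain ⟨p1, -, -, p4, p5, -, p7⟩ := hpar hl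
      rw [hdiff _ _ hl]
      refine mul_neg_of_pos_of_neg hα (hG₂ _ _ _ _ _ (p1.trans_lt a2) (abs0 p4 p5 a2)
        (p7.trans_lt a2) (abs0 hα.le (by linarith) a2) ?_)
      rw [abs_lt]; constructor <;> linarith [hμ.1, hμ.2])
    (fun μ hμ => by
      obtain ⟨p1, -, -, p4, p5, -, p7⟩ := hpar hr
      rw [hdiff _ _ hr]
      refine mul_pos hα (hG₃ _ _ _ _ _ (p1.trans_lt a3) (abs0 p4 p5 a3)
        (p7.trans_lt a3) (abs0 hα.le (by linarith) a3) ?_)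
      rw [abs_lt]; constructor <;> linarith [hμ.1, hμ.2])
  obtain ⟨-, p2, p3, p4, p5, -, p7⟩ := hpar hζ
  obtain ⟨r1, r2⟩ := hrest hζ
  exact D.elliptic_of_tangency n (hmem ζ hζ) hsum hdif
    (hO _ _ _ _ _ _ _ (abs0 p2 p3 a1) (abs0 p4 p5 a1) (p7.trans_lt a1)
      (abs0 r1 (by linarith) a1) (by rw [abs_lt]; constructor <;> linarith [hμ.1, hμ.2])
      (hnear ζ hζ).1 (abs0 hα.le (by linarith) a1))
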